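/- Let $Q$ be a (Hausdorff) smooth $2$-manifold, $\rho$ a smooth Riemannian metric on $Q$, $h\in C^\infty(Q)$, and let $H:T^*Q\to\mathbb R$, $H(\alpha)=\tfrac12\langle\alpha,\rho^\sharp(\alpha)\rangle+h(q)$ for $\alpha\in T^*_qQ$. Let $\xi$ be a nowhere vanishing smooth one-form on $Q$ and let $\mathcal W\subset TT^*Q$ be the vertical subbundle whose fibre at $\alpha\in T_q^*Q$ is spanned by the vertical lift $\frac{d}{dt}\big|_{t=0}(\alpha+t\,\xi(q))$. Let $(q_0,0)\in T^*Q$ be a critical point of the Hamiltonian vector field $X_H$. Fix a smooth chart $(U,\varphi)$, $\varphi=(x,y)$, with $\varphi(q_0)=(0,0)$, that is adapted to $\xi$, i.e. $\xi$ and $dy$ span the same line in $T_q^*Q$ for all $q\in U$. Let $h(x,y)$ be the local expression of $h$, and let $\begin{pmatrix}a&b\\b&c\end{pmatrix}$ be the inverse of the matrix of $\rho$ in the coordinates $(x,y)$. Then the following are equivalent. (1) The system $(H,\mathcal W)$ is stabilizable at $(q_0,0)$, with this certified by a simple Lyapunov function: on an open neighbourhood $O$ of $(q_0,0)$ in $T^*Q$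 there are a smooth vector field $Y$ with values in $\mathcal W$, such that $(q_0,0)$ is a critical point of $X_H+Y$ at which $X_H+Y$ is stable in the sense of Lyapunov, and a function $V(\alpha)=\tfrac12\langle\alpha,\phi^\sharp(\alpha)\rangle+v(q)$, with $\phi$ a smooth Riemannian metric and $v$ a smooth function near $q_0$, such that $V(q_0,0)=0$, $V>0$ on $O\setminus\{(q_0,0)\}$, $\langle dV,X_H+Y\rangle\le0$ on $O$, and the Hessian of $v$ at $q_0$ is positive definite. (2) $\left[b\,h_{xx}+c\,h_{xy}\right](0,0)\neq0$ or $h_{xx}(0,0)>0$. -/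

import Mathlib

open Set Filter Topology Bundle
open scoped Manifold ContDiff

noncomputable section

namespace Underactuated

/-- The model plane. -/
abbrev Plane : Type := EuclideanSpace ℝ (Fin 2)

section Dynamics

variable {E H P : Type*} [NormedAddCommGroup E] [NormedSpace ℝ E] [TopologicalSpace H]
  (I : ModelWithCorners ℝ E H) [TopologicalSpace P] [ChartedSpace H P]

/-- Lyapunov stability at `α₀` of the vector field `X` given on `O`: trajectories starting close
enough to `α₀` stay as close to `α₀` as prescribed, for all positive times at which they exist. -/
def IsStableAt (X : ∀ α : P, TangentSpace I α) (O : Set P) (α₀ : P) : Prop :=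
  ∀ N ∈ 𝓝 α₀, ∃ N' ∈ 𝓝 α₀, ∀ (T : ℝ) (Γ : ℝ → P),
    IsMIntegralCurveOn (I := I) Γ X (Ico 0 T) → (∀ t ∈ Ico 0 T, Γ t ∈ O) → Γ 0 ∈ N' →
      ∀ t ∈ Ico 0 T, Γ t ∈ N

/-- The differential of a real function at a point. -/
def differential (V : P → ℝ) (α : P) : TangentSpace I α →L[ℝ] ℝ :=
  mfderiv I 𝓘(ℝ, ℝ) V α

/-- `V` is a Lyapunov function on `O` for the vector field `X` and its critical point `α₀`. -/
structure IsLyapunovFunction (X : ∀ α : P, TangentSpace I α) (O : Set P) (α₀ : P)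
    (V : P → ℝ) : Prop where
  critical : X α₀ = 0
  smooth : ContMDiffOn I 𝓘(ℝ, ℝ) ∞ V O
  zero : V α₀ = 0
  pos : ∀ α ∈ O, α ≠ α₀ → 0 < V α
  deriv_nonpos : ∀ α ∈ O, differential I V α (X α) ≤ 0

end Dynamics

section Cotangent

variable (Q : Type*) [TopologicalSpace Q] [ChartedSpace Plane Q] [IsManifold 𝓘(ℝ, Plane) ∞ Q]

/-- The cotangent bundle `T*Q`. Mathlib's bundle of continuous linear maps provides its
topology and its smooth structure. -/
abbrev CotangentBundle : Type _ :=
  TotalSpace (Plane →L[ℝ] ℝ) (fun q : Q => TangentSpace 𝓘(ℝ, Plane) q →L[ℝ] ℝ)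

/-- The model with corners of `T*Q`. -/
abbrev cotangentModel : ModelWithCorners ℝ (Plane × (Plane →L[ℝ] ℝ))
    (ModelProd Plane (Plane →L[ℝ] ℝ)) :=
  𝓘(ℝ, Plane).prod 𝓘(ℝ, Plane →L[ℝ] ℝ)

variable {Q}

/-- The point `(q, β)` of `T*Q`. -/
abbrev covector (q : Q) (β : TangentSpace 𝓘(ℝ, Plane) q →L[ℝ] ℝ) : CotangentBundle Q :=
  ⟨q, β⟩

/-- The vertical lift `d/dt|_{t=0} (α + t β)` of `β` at `α`. -/
def vlift (α : CotangentBundle Q) (β : TangentSpace 𝓘(ℝ, Plane) α.proj →L[ℝ] ℝ) :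
    TangentSpace cotangentModel α :=
  (mfderiv 𝓘(ℝ, ℝ) cotangentModel (fun t : ℝ => covector α.proj (α.snd + t • β)) 0
    (1 : ℝ) : Plane × (Plane →L[ℝ] ℝ))

/-- The actuation subbundle: at `α` it is spanned by the vertical lift of the one-form `ξ`. -/
def actuation (ξ : ∀ q : Q, TangentSpace 𝓘(ℝ, Plane) q →L[ℝ] ℝ) (α : CotangentBundle Q) :
    Submodule ℝ (TangentSpace cotangentModel α) :=
  Submodule.span ℝ {vlift α (ξ α.proj)}

/-- `g` is a smooth Riemannian metric on the set `U`. -/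
structure IsRiemannianMetricOn
    (g : ∀ q : Q, TangentSpace 𝓘(ℝ, Plane) q →L[ℝ] TangentSpace 𝓘(ℝ, Plane) q →L[ℝ] ℝ)
    (U : Set Q) : Prop where
  symm : ∀ q ∈ U, ∀ u w, g q u w = g q w u
  pos : ∀ q ∈ U, ∀ u, u ≠ 0 → 0 < g q u u
  smooth : ContMDiffOn 𝓘(ℝ, Plane) (𝓘(ℝ, Plane).prod 𝓘(ℝ, Plane →L[ℝ] Plane →L[ℝ] ℝ)) ∞
    (fun q => TotalSpace.mk' (Plane →L[ℝ] Plane →L[ℝ] ℝ)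
      (E := fun q : Q =>
        TangentSpace 𝓘(ℝ, Plane) q →L[ℝ] TangentSpace 𝓘(ℝ, Plane) q →L[ℝ] ℝ) q (g q)) U

/-- The map `g♯ : T*_q Q → T_q Q`, inverse of `u ↦ g(u, ·)`. -/
def sharp (g : ∀ q : Q, TangentSpace 𝓘(ℝ, Plane) q →L[ℝ] TangentSpace 𝓘(ℝ, Plane) q →L[ℝ] ℝ)
    (q : Q) : (TangentSpace 𝓘(ℝ, Plane) q →L[ℝ] ℝ) →L[ℝ] TangentSpace 𝓘(ℝ, Plane) q :=
  (g q).inverse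

/-- The simple (kinetic-plus-potential) function `α ↦ ½ ⟨α, g♯ α⟩ + w(q)` on `T*Q`. -/
def simpleFunction
    (g : ∀ q : Q, TangentSpace 𝓘(ℝ, Plane) q →L[ℝ] TangentSpace 𝓘(ℝ, Plane) q →L[ℝ] ℝ)
    (w : Q → ℝ) (α : CotangentBundle Q) : ℝ :=
  1 / 2 * α.snd (sharp g α.proj α.snd) + w α.proj

end Cotangent

section Coordinates

variable {Q : Type*} [TopologicalSpace Q] [ChartedSpace Plane Q] [IsManifold 𝓘(ℝ, Plane) ∞ Q]
  (φ : OpenPartialHomeomorph Q Plane)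

/-- The coordinate differential `dqⁱ` at `q`. -/
def coordForm (i : Fin 2) (q : Q) : TangentSpace 𝓘(ℝ, Plane) q →L[ℝ] ℝ :=
  mfderiv 𝓘(ℝ, Plane) 𝓘(ℝ, ℝ) (fun q' => φ q' i) q

/-- The coordinate vector `∂/∂qⁱ` at `q`. -/
def coordVector (i : Fin 2) (q : Q) : TangentSpace 𝓘(ℝ, Plane) q :=
  (mfderiv 𝓘(ℝ, Plane) 𝓘(ℝ, Plane) φ q).inverse (EuclideanSpace.single i (1 : ℝ) : Plane)

/-- The induced coordinates `(q, p)` on `T*Q`, with `pᵢ = ⟨α, ∂/∂qⁱ⟩`. -/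
def cotangentCoord (α : CotangentBundle Q) : Plane × Plane :=
  (φ α.proj, WithLp.toLp 2 fun i => α.snd (coordVector φ i α.proj))

/-- The inverse of the induced coordinates: `(q, p) ↦ ∑ pᵢ dqⁱ`. -/
def cotangentCoordSymm (z : Plane × Plane) : CotangentBundle Q :=
  covector (φ.symm z.1) (∑ i, z.2 i • coordForm φ i (φ.symm z.1))

/-- The Hamiltonian vector field
`∑ ∂H/∂pᵢ ∂/∂qⁱ - ∂H/∂qⁱ ∂/∂pᵢ` over the domain of the chart `φ` of `Q`. Changes of cotangent
coordinates preserve the canonical symplectic form, so all charts define the same field. -/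
def hamiltonianField (H : CotangentBundle Q → ℝ) (α : CotangentBundle Q) :
    TangentSpace cotangentModel α :=
  let z := cotangentCoord φ α
  let dH : Plane × Plane →L[ℝ] ℝ := fderiv ℝ (fun z' => H (cotangentCoordSymm φ z')) z
  let qdot : Plane := WithLp.toLp 2 fun i => dH (0, EuclideanSpace.single i 1)
  let pdot : Plane := WithLp.toLp 2 fun i => -dH (EuclideanSpace.single i 1, 0)
  (mfderiv 𝓘(ℝ, Plane × Plane) cotangentModel (cotangentCoordSymm φ) z (qdot, pdot) :
    Plane × (Plane →L[ℝ] ℝ))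

/-- The entries `⟨dqⁱ, g♯ dqʲ⟩` of the inverse of the matrix `g(∂/∂qⁱ, ∂/∂qʲ)`. -/
def cometricCoeff
    (g : ∀ q : Q, TangentSpace 𝓘(ℝ, Plane) q →L[ℝ] TangentSpace 𝓘(ℝ, Plane) q →L[ℝ] ℝ)
    (i j : Fin 2) (q : Q) : ℝ :=
  coordForm φ i q (sharp g q (coordForm φ j q))

/-- The second derivative at `q` of the local expression of `w` in the chart `φ`. -/
def hessian (w : Q → ℝ) (q : Q) : Plane →L[ℝ] Plane →L[ℝ] ℝ :=
  fderiv ℝ (fderiv ℝ (fun z => w (φ.symm z))) (φ q)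

/-- The second partial derivative `∂²w/∂qⁱ∂qʲ` at `q`. -/
def secondPartial (w : Q → ℝ) (i j : Fin 2) (q : Q) : ℝ :=
  hessian φ w q (EuclideanSpace.single i 1) (EuclideanSpace.single j 1)

/-- The chart `φ` is adapted to the rank one subbundle spanned by `ξ`, that is, the subbundle is
spanned by `dy`, where `(x, y)` are the coordinates of `φ`. -/
def IsAdapted (ξ : ∀ q : Q, TangentSpace 𝓘(ℝ, Plane) q →L[ℝ] ℝ) : Prop :=
  ∀ q ∈ φ.source, Submodule.span ℝ {ξ q} = Submodule.span ℝ {coordForm φ 1 q}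

/-- The system with Hamiltonian `H` and actuation `ξ` is stabilizable at `(q₀, 0)`, and this is
certified by a simple Lyapunov function: around `(q₀, 0)` there are a control law `Y` with values
in the actuation subbundle such that the closed-loop system `X_H + Y` is stable, and a simple
Lyapunov function `V = ½ ⟨α, g♯ α⟩ + v` for it, where the minimum `q₀` of `v` is nondegenerate. -/
def StabilizableBySimpleLyapunov (H : CotangentBundle Q → ℝ)
    (ξ : ∀ q : Q, TangentSpace 𝓘(ℝ, Plane) q →L[ℝ] ℝ) (q₀ : Q) : Prop :=
  ∃ (U : Set Q) (O : Set (CotangentBundle Q))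
    (Y : ∀ α : CotangentBundle Q, TangentSpace cotangentModel α)
    (g : ∀ q : Q, TangentSpace 𝓘(ℝ, Plane) q →L[ℝ] TangentSpace 𝓘(ℝ, Plane) q →L[ℝ] ℝ)
    (v : Q → ℝ),
    IsOpen U ∧ q₀ ∈ U ∧ U ⊆ φ.source ∧
    IsOpen O ∧ covector q₀ 0 ∈ O ∧ (∀ α ∈ O, α.proj ∈ U) ∧
    ContMDiffOn cotangentModel cotangentModel.tangent ∞
      (fun α => (⟨α, Y α⟩ : TangentBundle cotangentModel (CotangentBundle Q))) O ∧
    (∀ α ∈ O, Y α ∈ actuation ξ α) ∧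
    IsStableAt cotangentModel (fun α => hamiltonianField φ H α + Y α) O (covector q₀ 0) ∧
    IsRiemannianMetricOn g U ∧
    ContMDiffOn 𝓘(ℝ, Plane) 𝓘(ℝ, ℝ) ∞ v U ∧
    IsLyapunovFunction cotangentModel (fun α => hamiltonianField φ H α + Y α) O (covector q₀ 0)
      (simpleFunction g v) ∧
    (∀ u : Plane, u ≠ 0 → 0 < hessian φ v q₀ u u)

end Coordinates

end Underactuated

end

/-!
In canonical coordinates `(x, p)` let `A` and `F` be the cometrics of `ρ` and of the kinetic part
of `V`, and let `e = ∂/∂x`, which `ξ` annihilates. On the covectors `p` with `⟪F p, dy⟫ = 0` the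
control does no work, so there the decay condition reads `⟨dV, X_H⟩ ≤ 0`. Its left-hand side is odd
in `p`, hence vanishes, and its part linear in `p` is the matching equation `dv (A w) = dh e`, where
`F w = e`. Differentiating at `q₀` along `A w` gives `D²h (A w, e) = D²v (A w, A w) > 0`, while
`w 0 = ⟪w, F w⟫ > 0`; by linear algebra such a `w` exists exactly under condition (2).

Conversely, given such a `w` at `q₀`, put `ν = A w` and keep `ν` constant. The cometric
`c p₀² + (p₁ - r p₀)²` turns the matching conditions into two linear first-order equations along
`ν`, one for `log c` and one for the potential `v`; adding to `v` a quadratic term that is constant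
along `ν` makes its Hessian positive definite. The resulting feedback conserves `V`.
-/

noncomputable section

namespace Underactuated

open scoped InnerProductSpace

section Calculus

variable {E : Type*} [NormedAddCommGroup E] [NormedSpace ℝ E]
  {F : Type*} [NormedAddCommGroup F] [NormedSpace ℝ F]

theorem fderiv_fderiv_comm {f : E → F} {x : E} (hf : ContDiffAt ℝ ∞ f x) (u w : E) :
    fderiv ℝ (fderiv ℝ f) x u w = fderiv ℝ (fderiv ℝ f) x w u :=
  (hf.isSymmSndFDerivAt (by simpa using ENat.LEInfty.out)).eq u w

theorem eventually_differentiableAt {f : E → F} {x : E} (hf : ContDiffAt ℝ ∞ f x) :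
    ∀ᶠ y in 𝓝 x, DifferentiableAt ℝ f y :=
  ((hf.of_le (m := 1) (by simp)).eventually (by simp)).mono fun _ hy =>
    hy.differentiableAt (by simp)

theorem hasFDerivAt_fderiv {f : E → F} {x : E} (hf : ContDiffAt ℝ ∞ f x) :
    HasFDerivAt (fderiv ℝ f) (fderiv ℝ (fderiv ℝ f) x) x :=
  ((hf.fderiv_right (m := ∞) (by simp)).differentiableAt (by simp)).hasFDerivAt

theorem fderiv_fderiv_apply {f : E → F} {x : E} (hf : ContDiffAt ℝ ∞ f x) (u w : E) :
    fderiv ℝ (fun y => fderiv ℝ f y w) x u = fderiv ℝ (fderiv ℝ f) x u w := by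
  simp [((hasFDerivAt_fderiv hf).clm_apply (hasFDerivAt_const w x)).fderiv]

theorem fderiv_fderiv_apply_of_fderiv_eq {v h : E → F} {u : E → E} {x e : E}
    (hv : ContDiffAt ℝ ∞ v x) (hh : ContDiffAt ℝ ∞ h x) (hu : DifferentiableAt ℝ u x)
    (hv0 : fderiv ℝ v x = 0) (heq : ∀ᶠ y in 𝓝 x, fderiv ℝ v y (u y) = fderiv ℝ h y e) (w : E) :
    fderiv ℝ (fderiv ℝ v) x w (u x) = fderiv ℝ (fderiv ℝ h) x w e := by
  have hvu := ((hasFDerivAt_fderiv hv).clm_apply hu.hasFDerivAt).fderiv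
  rw [← fderiv_fderiv_apply hh, ← EventuallyEq.fderiv_eq heq, hvu]
  simp [hv0]

theorem fderiv_apply_eq_zero_of_forall_add_smul_eq {f : E → F} (hf : Differentiable ℝ f)
    {x w : E} {c : F} (h : ∀ s : ℝ, f (x + s • w) = c) (s : ℝ) :
    fderiv ℝ f (x + s • w) w = 0 := by
  have hline : HasDerivAt (fun s : ℝ => x + s • w) w s := by
    simpa using ((hasDerivAt_id s).smul_const w).const_add x
  have hcomp := (hf (x + s • w)).hasFDerivAt.comp_hasDerivAt s hline
  rw [show f ∘ (fun s : ℝ => x + s • w) = fun _ => c from funext h] at hcomp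
  exact hcomp.unique (hasDerivAt_const s c)

theorem fderiv_fderiv_apply_eq_zero_of_forall_add_smul_eq {f : E → F} (hf : ContDiff ℝ ∞ f)
    {x w : E} {c : F} (h : ∀ s : ℝ, f (x + s • w) = c) :
    fderiv ℝ (fderiv ℝ f) x w w = 0 := by
  have hdf : ContDiff ℝ ∞ (fun y => fderiv ℝ f y w) :=
    (hf.fderiv_right (by simp)).clm_apply contDiff_const
  have hzero := fderiv_apply_eq_zero_of_forall_add_smul_eq (hdf.differentiable (by simp))
    (fderiv_apply_eq_zero_of_forall_add_smul_eq (hf.differentiable (by simp)) h) 0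
  rw [zero_smul, add_zero] at hzero
  rw [← fderiv_fderiv_apply hf.contDiffAt, hzero]

theorem hasFDerivAt_half_bilin {B : E →L[ℝ] E →L[ℝ] ℝ} (hB : ∀ u w, B u w = B w u) (x y : E) :
    HasFDerivAt (fun y => 1 / 2 * B (y - x) (y - x)) (B (y - x)) y := by
  have hsub : HasFDerivAt (fun y => y - x) (ContinuousLinearMap.id ℝ E) y :=
    (hasFDerivAt_id y).sub_const x
  refine (((B.hasFDerivAt.comp y hsub).clm_apply hsub).const_mul (1 / 2)).congr_fderiv ?_
  ext u
  simp [hB u]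
  ring

theorem isLittleO_sq_of_fderiv_isLittleO {f : E → F} {x : E}
    (hf : ∀ᶠ y in 𝓝 x, DifferentiableAt ℝ f y) (hx : f x = 0)
    (hdf : fderiv ℝ f =o[𝓝 x] fun y => y - x) : f =o[𝓝 x] fun y => ‖y - x‖ ^ 2 := by
  refine Asymptotics.isLittleO_iff.2 fun c hc => ?_
  obtain ⟨r, hr, hball⟩ := Metric.eventually_nhds_iff_ball.1 ((hdf.def hc).and hf)
  filter_upwards [Metric.ball_mem_nhds x hr] with y hy
  have hmem (z) (hz : z ∈ Metric.closedBall x ‖y - x‖) :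
      ‖z - x‖ ≤ ‖y - x‖ ∧ z ∈ Metric.ball x r := by
    rw [mem_closedBall_iff_norm] at hz
    rw [mem_ball_iff_norm] at hy ⊢
    exact ⟨hz, hz.trans_lt hy⟩
  have hbound : ‖f y - f x‖ ≤ c * ‖y - x‖ * ‖y - x‖ := by
    refine (convex_closedBall x ‖y - x‖).norm_image_sub_le_of_norm_fderiv_le (𝕜 := ℝ)
      (fun z hz => (hball z (hmem z hz).2).2) (fun z hz => (hball z (hmem z hz).2).1.trans ?_)
      (Metric.mem_closedBall_self (norm_nonneg _)) (mem_closedBall_iff_norm.2 le_rfl)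
    have := (hmem z hz).1
    gcongr
  rw [hx, sub_zero] at hbound
  rwa [norm_pow, norm_norm, sq, ← mul_assoc]

theorem isLittleO_sub_half_fderiv_fderiv {f : E → ℝ} {x : E} (hf : ContDiffAt ℝ ∞ f x)
    (h0 : f x = 0) (h1 : fderiv ℝ f x = 0) :
    (fun y => f y - 1 / 2 * fderiv ℝ (fderiv ℝ f) x (y - x) (y - x)) =o[𝓝 x]
      fun y => ‖y - x‖ ^ 2 := by
  have hquad (y : E) := hasFDerivAt_half_bilin (fderiv_fderiv_comm hf) x y
  have hdiff := eventually_differentiableAt hf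
  refine isLittleO_sq_of_fderiv_isLittleO
    (hdiff.mono fun y hy => hy.sub (hquad y).differentiableAt) (by simp [h0]) ?_
  refine (hasFDerivAt_fderiv hf).isLittleO.congr' ?_ EventuallyEq.rfl
  filter_upwards [hdiff] with y hy
  rw [h1, sub_zero]
  exact (hy.hasFDerivAt.sub (hquad y)).fderiv.symm

theorem eventually_pos_of_isCoercive_fderiv_fderiv {f : E → ℝ} {x : E} (hf : ContDiffAt ℝ ∞ f x)
    (h0 : f x = 0) (h1 : fderiv ℝ f x = 0) (h2 : IsCoercive (fderiv ℝ (fderiv ℝ f) x)) :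
    ∀ᶠ y in 𝓝 x, y ≠ x → 0 < f y := by
  obtain ⟨c, hc, hcoercive⟩ := h2
  have ho := (isLittleO_sub_half_fderiv_fderiv hf h0 h1).def (c := c / 4) (by positivity)
  filter_upwards [ho] with y hy hne
  have hnorm : 0 < ‖y - x‖ := norm_pos_iff.2 (sub_ne_zero.2 hne)
  rw [norm_pow, norm_norm] at hy
  have hlower := (abs_le.1 hy).1
  have hform := hcoercive (y - x)
  have : 0 < c * ‖y - x‖ ^ 2 := by positivity
  nlinarith

theorem isCoercive_of_pos [ProperSpace E] {B : E →L[ℝ] E →L[ℝ] ℝ}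
    (hB : ∀ u, u ≠ 0 → 0 < B u u) : IsCoercive B := by
  obtain hE | hE := subsingleton_or_nontrivial E
  · exact ⟨1, one_pos, fun u => by simp [Subsingleton.elim u 0]⟩
  obtain ⟨u₀, hu₀, hmin⟩ := (isCompact_sphere (0 : E) 1).exists_isMinOn
    (f := fun u => B u u) (NormedSpace.sphere_nonempty.2 zero_le_one)
    (by fun_prop : Continuous fun u => B u u).continuousOn
  have hu₀_ne : u₀ ≠ 0 := by
    rintro rfl
    simp at hu₀
  refine ⟨B u₀ u₀, hB u₀ hu₀_ne, fun u => ?_⟩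
  obtain rfl | hu := eq_or_ne u 0
  · simp
  have hle : B u₀ u₀ ≤ B (‖u‖⁻¹ • u) (‖u‖⁻¹ • u) := hmin (by simp [norm_smul, hu])
  simp only [map_smul, smul_apply, smul_eq_mul] at hle
  calc B u₀ u₀ * ‖u‖ * ‖u‖ ≤ (‖u‖⁻¹ * (‖u‖⁻¹ * B u u)) * ‖u‖ * ‖u‖ := by gcongr
    _ = B u u := by field_simp

end Calculus

section Extension

variable {E : Type*} [NormedAddCommGroup E] [NormedSpace ℝ E] [HasContDiffBump E]
  {F : Type*} [NormedAddCommGroup F] [NormedSpace ℝ F]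

theorem exists_contDiff_eventuallyEq {f : E → F} {x₀ : E}
    (hf : ∀ᶠ x in 𝓝 x₀, ContDiffAt ℝ ∞ f x) :
    ∃ f' : E → F, ContDiff ℝ ∞ f' ∧ f' =ᶠ[𝓝 x₀] f := by
  obtain ⟨χ, hχ⟩ : ∃ χ : ContDiffBump x₀, tsupport χ ⊆ {x | ContDiffAt ℝ ∞ f x} := by
    obtain ⟨r, hr, hball⟩ := Metric.eventually_nhds_iff_ball.1 hf
    refine ⟨⟨r / 4, r / 2, by positivity, by linarith⟩, ?_⟩
    rw [ContDiffBump.tsupport_eq]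
    exact fun x hx => hball x (Metric.closedBall_subset_ball (by linarith) hx)
  refine ⟨fun x => χ x • f x, contDiff_iff_contDiffAt.2 fun x => ?_, ?_⟩
  · by_cases hx : x ∈ tsupport χ
    · exact χ.contDiffAt.smul (hχ hx)
    · refine (contDiffAt_const (c := (0 : F))).congr_of_eventuallyEq ?_
      filter_upwards [(isClosed_tsupport χ).isOpen_compl.mem_nhds hx] with y hy
      rw [image_eq_zero_of_notMem_tsupport hy, zero_smul]
  · filter_upwards [χ.eventuallyEq_one] with y hy
    rw [hy, Pi.one_apply, one_smul]

end Extension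

section ParametricIntegral

open MeasureTheory

theorem hasFDerivAt_parametric_intervalIntegral {E F : Type*} [NormedAddCommGroup E]
    [NormedSpace ℝ E] [ProperSpace E] [NormedAddCommGroup F] [NormedSpace ℝ F]
    {f : E × ℝ → F} (hf : ContDiff ℝ 1 f) (a b : ℝ) (x : E) :
    HasFDerivAt (fun x => ∫ t in a..b, f (x, t))
      (∫ t in a..b, fderiv ℝ f (x, t) ∘L ContinuousLinearMap.inl ℝ E ℝ) x := by
  have hcont : Continuous fun z : E × ℝ => fderiv ℝ f z ∘L ContinuousLinearMap.inl ℝ E ℝ :=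
    (hf.continuous_fderiv (by simp)).clm_comp continuous_const
  obtain ⟨C, hC⟩ := ((isCompact_closedBall x 1).prod
    (isCompact_uIcc (a := a) (b := b))).exists_bound_of_continuousOn hcont.continuousOn
  refine intervalIntegral.hasFDerivAt_integral_of_dominated_of_fderiv_le (𝕜 := ℝ)
    (F := fun x t => f (x, t))
    (F' := fun x t => fderiv ℝ f (x, t) ∘L ContinuousLinearMap.inl ℝ E ℝ)
    (bound := fun _ => C) (Metric.closedBall_mem_nhds x one_pos)
    (Eventually.of_forall fun y =>
      (hf.continuous.comp (by fun_prop : Continuous fun t : ℝ => (y, t))).aestronglyMeasurable)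
    ((hf.continuous.comp (by fun_prop)).intervalIntegrable _ _)
    (hcont.comp (by fun_prop : Continuous fun t : ℝ => (x, t))).aestronglyMeasurable
    (Eventually.of_forall fun t ht y hy => hC (y, t) ⟨hy, uIoc_subset_uIcc ht⟩)
    intervalIntegrable_const (Eventually.of_forall fun t _ y _ => ?_)
  exact (hf.differentiable (by simp) (y, t)).hasFDerivAt.comp y (hasFDerivAt_prodMk_left y t)

universe u v

-- The induction replaces `F` by `E →L[ℝ] F`, so the universe of `F` has to absorb that of `E`.
theorem contDiff_nat_parametric_intervalIntegral {E : Type u} [NormedAddCommGroup E]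
    [NormedSpace ℝ E] [ProperSpace E] (a b : ℝ) (n : ℕ) :
    ∀ {F : Type (max u v)} [NormedAddCommGroup F] [NormedSpace ℝ F] {f : E × ℝ → F},
      ContDiff ℝ n f → ContDiff ℝ n (fun x => ∫ t in a..b, f (x, t)) := by
  induction n with
  | zero =>
    intro F _ _ f hf
    exact contDiff_zero.2 (intervalIntegral.continuous_parametric_intervalIntegral_of_continuous'
      (f := fun x t => f (x, t)) hf.continuous a b)
  | succ n ih =>
    intro F _ _ f hf
    refine contDiff_succ_iff_hasFDerivAt.2 ⟨_, ?_,
      hasFDerivAt_parametric_intervalIntegral (hf.of_le (by norm_cast; omega)) a b⟩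
    exact ih (f := fun z => fderiv ℝ f z ∘L ContinuousLinearMap.inl ℝ E ℝ)
      ((hf.fderiv_right (by norm_cast)).clm_comp contDiff_const)

theorem contDiff_parametric_intervalIntegral {E : Type u} [NormedAddCommGroup E]
    [NormedSpace ℝ E] [ProperSpace E] {F : Type v} [NormedAddCommGroup F] [NormedSpace ℝ F]
    {f : E × ℝ → F} (hf : ContDiff ℝ ∞ f) (a b : ℝ) :
    ContDiff ℝ ∞ (fun x => ∫ t in a..b, f (x, t)) := by
  refine contDiff_infty.2 fun n => ContDiff.of_le (n := (n + 1 : ℕ))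
    (contDiff_succ_iff_hasFDerivAt.2 ⟨_, ?_,
      hasFDerivAt_parametric_intervalIntegral (hf.of_le (by simp)) a b⟩) (by norm_cast; omega)
  exact contDiff_nat_parametric_intervalIntegral.{u, v} a b n
    (f := fun z => fderiv ℝ f z ∘L ContinuousLinearMap.inl ℝ E ℝ)
    (((hf.fderiv_right (m := ∞) (by simp)).clm_comp contDiff_const).of_le
      (by exact_mod_cast le_top))

end ParametricIntegral

section DirectionalDerivative

theorem exists_fderiv_apply_eq {E : Type*} [NormedAddCommGroup E] [NormedSpace ℝ E]
    [ProperSpace E] {F : Type*} [NormedAddCommGroup F] [NormedSpace ℝ F] [CompleteSpace F]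
    {G : E → F} (hG : ContDiff ℝ ∞ G) {n : E} {ℓ : E →L[ℝ] ℝ} (hn : ℓ n = 1) (x₀ : E) :
    ∃ f : E → F, ContDiff ℝ ∞ f ∧ (∀ x, fderiv ℝ f x n = G x) ∧
      ∀ x, ℓ (x - x₀) = 0 → f x = 0 := by
  let f : E → F := fun x => ∫ t in (0 : ℝ)..1,
    ℓ (x - x₀) • G (x - ℓ (x - x₀) • n + (t * ℓ (x - x₀)) • n)
  have hf : ContDiff ℝ ∞ f := contDiff_parametric_intervalIntegral
    (f := fun z : E × ℝ => ℓ (z.1 - x₀) • G (z.1 - ℓ (z.1 - x₀) • n + (z.2 * ℓ (z.1 - x₀)) • n))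
    (by fun_prop) 0 1
  have hf_line (x : E) : f x = ∫ t in (0 : ℝ)..ℓ (x - x₀), G (x - ℓ (x - x₀) • n + t • n) := by
    have := intervalIntegral.smul_integral_comp_mul_right (a := 0) (b := 1)
      (f := fun t => G (x - ℓ (x - x₀) • n + t • n)) (ℓ (x - x₀))
    rw [zero_mul, one_mul] at this
    rw [← this, ← intervalIntegral.integral_smul]
  refine ⟨f, hf, fun x => ?_, fun x hx => by
    simp only [f, hx, zero_smul, intervalIntegral.integral_zero]⟩
  have hshift : HasDerivAt (fun s : ℝ => ℓ (x - x₀) + s) 1 0 := (hasDerivAt_id (0 : ℝ)).const_add _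
  have hFTC : HasDerivAt (fun s : ℝ => ∫ t in (0 : ℝ)..s, G (x - ℓ (x - x₀) • n + t • n))
      (G x) (ℓ (x - x₀) + 0) := by
    have hcont : Continuous fun t : ℝ => G (x - ℓ (x - x₀) • n + t • n) :=
      hG.continuous.comp (by fun_prop)
    simpa using (hcont.integral_hasStrictDerivAt 0 (ℓ (x - x₀) + 0)).hasDerivAt
  have hderiv : HasDerivAt (fun s : ℝ => f (x + s • n)) (G x) 0 := by
    have hcomp := hFTC.scomp (0 : ℝ) hshift
    rw [one_smul] at hcomp
    refine hcomp.congr_of_eventuallyEq (Eventually.of_forall fun s => ?_)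
    have hℓ : ℓ (x + s • n - x₀) = ℓ (x - x₀) + s := by
      rw [add_sub_right_comm, map_add, map_smul, hn, smul_eq_mul, mul_one]
    have hfoot : x + s • n - (ℓ (x - x₀) + s) • n = x - ℓ (x - x₀) • n := by
      rw [add_smul]
      abel
    simp only [hf_line, hℓ, hfoot, Function.comp_apply]
  exact (hf.differentiable (by simp) x).lineDeriv_eq_fderiv.symm.trans hderiv.deriv

theorem exists_bilin_add_pos {E : Type*} [NormedAddCommGroup E] [InnerProductSpace ℝ E]
    {D : E →L[ℝ] E →L[ℝ] ℝ} (hsymm : ∀ u w, D u w = D w u) {n : E} (hn : 0 < D n n)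
    {ℓ : E →L[ℝ] ℝ} (hℓ : ℓ n = 1) (hker : ∀ w, ℓ w = 0 → 0 ≤ D w w) :
    ∃ B : E →L[ℝ] E →L[ℝ] ℝ, (∀ u w, B u w = B w u) ∧ B n = 0 ∧
      ∀ u, u ≠ 0 → 0 < D u u + B u u := by
  let T : E →L[ℝ] E := ContinuousLinearMap.id ℝ E - ℓ.smulRight n
  have hT (u : E) : T u = u - ℓ u • n := rfl
  let K := ‖D n‖ ^ 2 / D n n + 1
  let B : E →L[ℝ] E →L[ℝ] ℝ := K • (innerSL ℝ).bilinearComp T T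
  have hB (u w : E) : B u w = K * inner ℝ (T u) (T w) := rfl
  refine ⟨B, fun u w => by rw [hB, hB, real_inner_comm], ?_, fun u hu => ?_⟩
  · ext w
    simp [hB, hT n, hℓ]
  have hdecomp : u = ℓ u • n + T u := by simp [hT]
  have hexpand : D u u = ℓ u ^ 2 * D n n + 2 * ℓ u * D n (T u) + D (T u) (T u) := by
    conv_lhs => rw [hdecomp]
    simp only [map_add, map_smul, add_apply, smul_apply, smul_eq_mul, hsymm (T u) n]
    ring
  have hTu : 0 ≤ D (T u) (T u) := hker _ (by simp [hT, hℓ])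
  have hcross : D n (T u) ^ 2 ≤ ‖D n‖ ^ 2 * ‖T u‖ ^ 2 := by
    rw [← mul_pow, ← sq_abs]
    exact pow_le_pow_left₀ (abs_nonneg _) ((D n).le_opNorm (T u)) 2
  have hsquare : D n n * (ℓ u + D n (T u) / D n n) ^ 2 + ‖T u‖ ^ 2 ≤ D u u + B u u := by
    have hdiv : D n (T u) ^ 2 / D n n ≤ ‖D n‖ ^ 2 * ‖T u‖ ^ 2 / D n n := by gcongr
    have hcomplete : D n n * (ℓ u + D n (T u) / D n n) ^ 2 =
        ℓ u ^ 2 * D n n + 2 * ℓ u * D n (T u) + D n (T u) ^ 2 / D n n := by field_simp; ring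
    rw [hexpand, hB, real_inner_self_eq_norm_sq, hcomplete]
    linear_combination hdiv + hTu
  refine lt_of_lt_of_le ?_ hsquare
  obtain hzero | hne := eq_or_ne (T u) 0
  · have hℓu : ℓ u ≠ 0 := fun h => hu (by rw [hdecomp, hzero, h]; simp)
    rw [hzero, map_zero, zero_div, add_zero]
    positivity
  · have : 0 < ‖T u‖ := norm_pos_iff.2 hne
    positivity

theorem exists_fderiv_apply_eq_of_fderiv_pos {E : Type*} [NormedAddCommGroup E]
    [InnerProductSpace ℝ E] [ProperSpace E] {G : E → ℝ} (hG : ContDiff ℝ ∞ G) {x₀ n : E}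
    (hG₀ : G x₀ = 0) (hn : 0 < fderiv ℝ G x₀ n) :
    ∃ v : E → ℝ, ContDiff ℝ ∞ v ∧ (∀ x, fderiv ℝ v x n = G x) ∧ v x₀ = 0 ∧
      fderiv ℝ v x₀ = 0 ∧ ∀ u, u ≠ 0 → 0 < fderiv ℝ (fderiv ℝ v) x₀ u u := by
  obtain ⟨ℓ, hℓ⟩ : ∃ ℓ : E →L[ℝ] ℝ, ℓ n = 1 :=
    SeparatingDual.exists_eq_one (by rintro rfl; simp at hn)
  obtain ⟨P, hP, hPn, hP₀⟩ := exists_fderiv_apply_eq hG hℓ x₀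
  have hP_line {w : E} (hw : ℓ w = 0) (s : ℝ) : P (x₀ + s • w) = 0 := hP₀ _ (by simp [hw])
  have hdP₀ : fderiv ℝ P x₀ = 0 := by
    ext u
    have hker := fderiv_apply_eq_zero_of_forall_add_smul_eq (hP.differentiable (by simp))
      (hP_line (w := u - ℓ u • n) (by simp [hℓ])) 0
    simpa [hPn, hG₀] using hker
  have hddPn : fderiv ℝ (fderiv ℝ P) x₀ n n = fderiv ℝ G x₀ n := by
    simp_rw [← fderiv_fderiv_apply hP.contDiffAt, hPn]
  obtain ⟨B, hBsymm, hBn, hpos⟩ := exists_bilin_add_pos (fderiv_fderiv_comm hP.contDiffAt)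
    (hddPn ▸ hn) hℓ fun w hw =>
      (fderiv_fderiv_apply_eq_zero_of_forall_add_smul_eq hP (hP_line hw)).ge
  let v : E → ℝ := fun x => P x + 1 / 2 * B (x - x₀) (x - x₀)
  have hdv : fderiv ℝ v = fun x => fderiv ℝ P x + B (x - x₀) := funext fun x =>
    ((hP.differentiable (by simp) x).hasFDerivAt.add (hasFDerivAt_half_bilin hBsymm x₀ x)).fderiv
  have hddv : fderiv ℝ (fderiv ℝ v) x₀ = fderiv ℝ (fderiv ℝ P) x₀ + B := by
    rw [hdv]
    exact ((hasFDerivAt_fderiv hP.contDiffAt).add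
      (B.hasFDerivAt.comp x₀ ((hasFDerivAt_id x₀).sub_const x₀))).fderiv
  refine ⟨v, by fun_prop, fun x => ?_, by simp [v, hP₀], by simp [hdv, hdP₀], fun u hu => ?_⟩
  · simp [hdv, hPn, hBsymm _ n, hBn]
  · simpa [hddv] using hpos u hu

end DirectionalDerivative

section CanonicalCoordinates

variable {E : Type*} [NormedAddCommGroup E] [InnerProductSpace ℝ E]

/-- The simple function `½ ⟨p, A(x) p⟩ + w(x)` in canonical coordinates `(x, p)`, where covectors
are identified with vectors through the inner product. -/
def simpleEnergy (A : E → E →L[ℝ] E) (w : E → ℝ) (z : E × E) : ℝ :=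
  1 / 2 * ⟪z.2, A z.1 z.2⟫_ℝ + w z.1

/-- The Hamiltonian vector field `(∂K/∂p, -∂K/∂x)` of `K` in canonical coordinates `(x, p)`. -/
def symplecticGradient [CompleteSpace E] (K : E × E → ℝ) (z : E × E) : E × E :=
  ((InnerProductSpace.toDual ℝ E).symm (fderiv ℝ K z ∘L ContinuousLinearMap.inr ℝ E E),
    -(InnerProductSpace.toDual ℝ E).symm (fderiv ℝ K z ∘L ContinuousLinearMap.inl ℝ E E))

theorem inner_symplecticGradient_fst [CompleteSpace E] (K : E × E → ℝ) (z : E × E) (u : E) :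
    ⟪(symplecticGradient K z).1, u⟫_ℝ = fderiv ℝ K z (0, u) := by
  simp [symplecticGradient]

theorem inner_symplecticGradient_snd [CompleteSpace E] (K : E × E → ℝ) (z : E × E) (u : E) :
    ⟪(symplecticGradient K z).2, u⟫_ℝ = -fderiv ℝ K z (u, 0) := by
  simp [symplecticGradient]

variable {A F : E → E →L[ℝ] E} {h v : E → ℝ} {x : E}

theorem contDiffAt_simpleEnergy (hA : ContDiffAt ℝ ∞ A x) (hh : ContDiffAt ℝ ∞ h x) (p : E) :
    ContDiffAt ℝ ∞ (simpleEnergy A h) (x, p) := by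
  have hA' : ContDiffAt ℝ ∞ (fun z : E × E => A z.1) (x, p) := hA.comp (x, p) contDiffAt_fst
  have hh' : ContDiffAt ℝ ∞ (fun z : E × E => h z.1) (x, p) := hh.comp (x, p) contDiffAt_fst
  exact (contDiffAt_const.mul (contDiffAt_snd.inner ℝ (hA'.clm_apply contDiffAt_snd))).add hh'

theorem fderiv_simpleEnergy_apply (hA : DifferentiableAt ℝ A x)
    (hsymm : ∀ p q, ⟪A x p, q⟫_ℝ = ⟪p, A x q⟫_ℝ) (hh : DifferentiableAt ℝ h x) (p x' p' : E) :
    fderiv ℝ (simpleEnergy A h) (x, p) (x', p') =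
      1 / 2 * ⟪p, fderiv ℝ A x x' p⟫_ℝ + fderiv ℝ h x x' + ⟪A x p, p'⟫_ℝ := by
  have hAp : HasFDerivAt (fun z : E × E => A z.1 z.2) _ (x, p) :=
    (hA.hasFDerivAt.comp (x, p) hasFDerivAt_fst).clm_apply hasFDerivAt_snd
  have hh' : HasFDerivAt (fun z : E × E => h z.1) _ (x, p) :=
    hh.hasFDerivAt.comp (x, p) hasFDerivAt_fst
  have hK : HasFDerivAt (simpleEnergy A h) _ (x, p) :=
    ((hasFDerivAt_snd.inner ℝ hAp).const_mul (1 / 2)).add hh'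
  rw [hK.fderiv]
  simp [fderivInnerCLM_apply, inner_add_right, hsymm, real_inner_comm (A x p) p']
  ring

theorem fderiv_simpleEnergy_symplecticGradient [CompleteSpace E] (hA : DifferentiableAt ℝ A x)
    (hA_symm : ∀ p q, ⟪A x p, q⟫_ℝ = ⟪p, A x q⟫_ℝ) (hh : DifferentiableAt ℝ h x)
    (hF : DifferentiableAt ℝ F x) (hF_symm : ∀ p q, ⟪F x p, q⟫_ℝ = ⟪p, F x q⟫_ℝ)
    (hv : DifferentiableAt ℝ v x) (p τ : E) :
    fderiv ℝ (simpleEnergy F v) (x, p) (symplecticGradient (simpleEnergy A h) (x, p) + (0, τ)) =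
      1 / 2 * (⟪p, fderiv ℝ F x (A x p) p⟫_ℝ - ⟪p, fderiv ℝ A x (F x p) p⟫_ℝ) +
        (fderiv ℝ v x (A x p) - fderiv ℝ h x (F x p)) + ⟪F x p, τ⟫_ℝ := by
  have hqdot : (symplecticGradient (simpleEnergy A h) (x, p)).1 = A x p :=
    ext_inner_right ℝ fun u => by
      simp [inner_symplecticGradient_fst, fderiv_simpleEnergy_apply hA hA_symm hh]
  have hpdot : ⟪F x p, (symplecticGradient (simpleEnergy A h) (x, p)).2⟫_ℝ =
      -(1 / 2 * ⟪p, fderiv ℝ A x (F x p) p⟫_ℝ + fderiv ℝ h x (F x p)) := by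
    simp [real_inner_comm, inner_symplecticGradient_snd, fderiv_simpleEnergy_apply hA hA_symm hh]
  rw [← Prod.mk.eta (p := symplecticGradient (simpleEnergy A h) (x, p)), Prod.mk_add_mk,
    fderiv_simpleEnergy_apply hF hF_symm hv, inner_add_right, hqdot, hpdot, add_zero]
  ring

theorem symplecticGradient_simpleEnergy_eq_zero_iff [CompleteSpace E] (hA : DifferentiableAt ℝ A x)
    (hA_symm : ∀ p q, ⟪A x p, q⟫_ℝ = ⟪p, A x q⟫_ℝ) (hh : DifferentiableAt ℝ h x) :
    symplecticGradient (simpleEnergy A h) (x, 0) = 0 ↔ fderiv ℝ h x = 0 := by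
  have hqdot : (symplecticGradient (simpleEnergy A h) (x, 0)).1 = 0 :=
    ext_inner_right ℝ fun u => by
      simp [inner_symplecticGradient_fst, fderiv_simpleEnergy_apply hA hA_symm hh]
  have hpdot (u : E) : ⟪(symplecticGradient (simpleEnergy A h) (x, 0)).2, u⟫_ℝ =
      -fderiv ℝ h x u := by
    simp [inner_symplecticGradient_snd, fderiv_simpleEnergy_apply hA hA_symm hh]
  rw [Prod.ext_iff, hqdot]
  refine ⟨fun ⟨_, hzero⟩ => ?_, fun hzero => ⟨rfl, ext_inner_right ℝ fun u => ?_⟩⟩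
  · ext u
    simpa [hzero] using (hpdot u).symm
  · simp [hpdot, hzero]

theorem inner_fderiv_apply_of_apply_eq {n u : E} {M : E → E →L[ℝ] E}
    (hA : DifferentiableAt ℝ A x) (hA_symm : ∀ p q, ⟪A x p, q⟫_ℝ = ⟪p, A x q⟫_ℝ)
    (hM : DifferentiableAt ℝ M x) (hAM : ∀ᶠ y in 𝓝 x, A y (M y n) = n) :
    ⟪M x n, fderiv ℝ A x u (M x n)⟫_ℝ = -⟪n, fderiv ℝ M x u n⟫_ℝ := by
  have hderiv := hA.hasFDerivAt.clm_apply (hM.hasFDerivAt.clm_apply (hasFDerivAt_const n x))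
  have hzero : A x (fderiv ℝ M x u n) + fderiv ℝ A x u (M x n) = 0 := by
    simpa using DFunLike.congr_fun (hderiv.unique
      ((hasFDerivAt_const n x).congr_of_eventuallyEq hAM)) u
  rw [eq_neg_of_add_eq_zero_right hzero, inner_neg_right, ← hA_symm, hAM.self_of_nhds]

end CanonicalCoordinates

section MetricOperator

variable {E : Type*} [NormedAddCommGroup E] [InnerProductSpace ℝ E]

/-- `A` is a smooth Riemannian metric, or equally a smooth cometric, on the set `S`: the bilinear
forms are represented by operators through the inner product of the model space. -/
structure IsMetricOperatorOn (A : E → E →L[ℝ] E) (S : Set E) : Prop where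
  symm : ∀ x ∈ S, ∀ p q, ⟪A x p, q⟫_ℝ = ⟪p, A x q⟫_ℝ
  pos : ∀ x ∈ S, ∀ p, p ≠ 0 → 0 < ⟪A x p, p⟫_ℝ
  isInvertible : ∀ x ∈ S, (A x).IsInvertible
  smooth : ContDiffOn ℝ ∞ A S

theorem isInvertible_of_inner_pos [FiniteDimensional ℝ E] {A : E →L[ℝ] E}
    (hA : ∀ p, p ≠ 0 → 0 < ⟪A p, p⟫_ℝ) : A.IsInvertible := by
  have hinj : Function.Injective (A : E →ₗ[ℝ] E) :=
    (injective_iff_map_eq_zero _).2 fun p hp => by_contra fun hne =>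
      (hA p hne).ne' (by rw [← ContinuousLinearMap.coe_coe, hp, inner_zero_left])
  exact ⟨(LinearEquiv.ofInjectiveEndo _ hinj).toContinuousLinearEquiv, rfl⟩

namespace IsMetricOperatorOn

variable {A : E → E →L[ℝ] E} {S : Set E}

theorem mono {T : Set E} (hA : IsMetricOperatorOn A S) (hT : T ⊆ S) : IsMetricOperatorOn A T :=
  ⟨fun x hx => hA.symm x (hT hx), fun x hx => hA.pos x (hT hx),
    fun x hx => hA.isInvertible x (hT hx), hA.smooth.mono hT⟩

theorem inverse [CompleteSpace E] (hA : IsMetricOperatorOn A S) :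
    IsMetricOperatorOn (fun x => (A x).inverse) S where
  symm x hx p q := by
    obtain ⟨e, he⟩ := hA.isInvertible x hx
    simpa [← he] using (hA.symm x hx (e.symm p) (e.symm q)).symm.trans (by simp [← he])
  pos x hx p hp := by
    obtain ⟨e, he⟩ := hA.isInvertible x hx
    simpa [← he, real_inner_comm] using hA.pos x hx (e.symm p) (by simpa using hp)
  isInvertible x hx := (hA.isInvertible x hx).inverse
  smooth x hx := (hA.isInvertible x hx).contDiffAt_map_inverse.comp_contDiffWithinAt x
    (hA.smooth x hx)

end IsMetricOperatorOn

end MetricOperator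

section Necessity

theorem eq_zero_of_cubic_nonpos {C A : ℝ} (h : ∀ᶠ s : ℝ in 𝓝 0, s * (s ^ 2 * C + A) ≤ 0) :
    A = 0 := by
  have hderiv : HasDerivAt (fun s : ℝ => s * (s ^ 2 * C + A)) A 0 := by
    refine ((hasDerivAt_id (0 : ℝ)).mul
      ((((hasDerivAt_id (0 : ℝ)).pow 2).mul_const C).add_const A)).congr_deriv ?_
    simp
  refine IsLocalMax.hasDerivAt_eq_zero ?_ hderiv
  filter_upwards [h] with s hs
  simpa using hs

variable {E : Type*} [NormedAddCommGroup E] [InnerProductSpace ℝ E] [CompleteSpace E]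
  {A F : E → E →L[ℝ] E} {h v : E → ℝ} {x e : E}

theorem fderiv_potential_eq_of_nonpos (hA : DifferentiableAt ℝ A x)
    (hA_symm : ∀ p q, ⟪A x p, q⟫_ℝ = ⟪p, A x q⟫_ℝ) (hh : DifferentiableAt ℝ h x)
    (hF : DifferentiableAt ℝ F x) (hF_symm : ∀ p q, ⟪F x p, q⟫_ℝ = ⟪p, F x q⟫_ℝ)
    (hv : DifferentiableAt ℝ v x)
    (hdecay : ∀ᶠ p in 𝓝 (0 : E), ∃ τ, ⟪e, τ⟫_ℝ = 0 ∧
      fderiv ℝ (simpleEnergy F v) (x, p)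
        (symplecticGradient (simpleEnergy A h) (x, p) + (0, τ)) ≤ 0)
    {w : E} (hw : F x w = e) : fderiv ℝ v x (A x w) = fderiv ℝ h x e := by
  refine sub_eq_zero.1 (eq_zero_of_cubic_nonpos
    (C := 1 / 2 * (⟪w, fderiv ℝ F x (A x w) w⟫_ℝ - ⟪w, fderiv ℝ A x e w⟫_ℝ)) ?_)
  have hline : Tendsto (fun s : ℝ => s • w) (𝓝 0) (𝓝 0) :=
    (by fun_prop : Continuous fun s : ℝ => s • w).tendsto' 0 0 (zero_smul ℝ w)
  filter_upwards [hline.eventually hdecay] with s hs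
  obtain ⟨τ, hτ, hle⟩ := hs
  rw [fderiv_simpleEnergy_symplecticGradient hA hA_symm hh hF hF_symm hv] at hle
  simp only [map_smul, hw, inner_smul_left, inner_smul_right, hτ, smul_apply, smul_eq_mul] at hle
  convert hle using 1
  simp
  ring

theorem exists_fderiv_fderiv_pos_of_nonpos {S : Set E} (hS : S ∈ 𝓝 x)
    (hA : IsMetricOperatorOn A S) (hh : ContDiffAt ℝ ∞ h x) (hF : IsMetricOperatorOn F S)
    (hv : ContDiffAt ℝ ∞ v x) (hv₀ : fderiv ℝ v x = 0)
    (hv_pos : ∀ u, u ≠ 0 → 0 < fderiv ℝ (fderiv ℝ v) x u u) (he : e ≠ 0)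
    (hdecay : ∀ᶠ z in 𝓝 (x, (0 : E)), ∃ τ, ⟪e, τ⟫_ℝ = 0 ∧
      fderiv ℝ (simpleEnergy F v) z (symplecticGradient (simpleEnergy A h) z + (0, τ)) ≤ 0) :
    ∃ w, 0 < ⟪e, w⟫_ℝ ∧ 0 < fderiv ℝ (fderiv ℝ h) x (A x w) e := by
  have hx : x ∈ S := mem_of_mem_nhds hS
  have hA_smooth := hA.smooth.contDiffAt hS
  have hF_smooth := hF.smooth.contDiffAt hS
  have hmatching : ∀ᶠ y in 𝓝 x, fderiv ℝ v y (A y ((F y).inverse e)) = fderiv ℝ h y e := by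
    rw [nhds_prod_eq] at hdecay
    filter_upwards [hdecay.curry, hS, eventually_differentiableAt hA_smooth,
      eventually_differentiableAt hh, eventually_differentiableAt hF_smooth,
      eventually_differentiableAt hv] with y hy hyS dA dh dF dv
    exact fderiv_potential_eq_of_nonpos dA (hA.symm y hyS) dh dF (hF.symm y hyS) dv hy
      ((hF.isInvertible y hyS).self_apply_inverse e)
  set w : E := (F x).inverse e with hw
  have hFw : F x w = e := (hF.isInvertible x hx).self_apply_inverse e
  have hw₀ : w ≠ 0 := fun h0 => he (by rw [← hFw, h0, map_zero])
  have hAw : A x w ≠ 0 := (map_ne_zero_iff _ (hA.isInvertible x hx).injective).2 hw₀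
  refine ⟨w, by simpa only [hFw] using hF.pos x hx w hw₀, ?_⟩
  have hG := (hF.inverse.smooth.contDiffAt hS).differentiableAt (by simp)
  rw [hw, ← fderiv_fderiv_apply_of_fderiv_eq hv hh ((hA_smooth.differentiableAt (by simp)).clm_apply
    (hG.clm_apply (differentiableAt_const e))) hv₀ hmatching]
  exact hv_pos _ hAw

end Necessity

section Manifold

variable {M : Type*} [TopologicalSpace M] {E E' H : Type*} [NormedAddCommGroup E] [NormedSpace ℝ E]
  [NormedAddCommGroup E'] [NormedSpace ℝ E'] [TopologicalSpace H] {I : ModelWithCorners ℝ E H}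
  [ChartedSpace H M]

theorem tangentBundle_mk_congr {x y : M} (h : x = y) (u : E) :
    (⟨x, u⟩ : TangentBundle I M) = ⟨y, u⟩ := by
  subst h; rfl

theorem contMDiffAt_pushforward [IsManifold I ∞ M] {F : E' → M} {S : Set E'} (hS : IsOpen S)
    (hF : ContMDiffOn 𝓘(ℝ, E') I ∞ F S) {G : M → E'} {x : M}
    (hG : ContMDiffAt I 𝓘(ℝ, E') ∞ G x) (hx : G x ∈ S) (hFG : ∀ᶠ y in 𝓝 x, F (G y) = y)
    {X : E' → E'} (hX : ContDiffAt ℝ ∞ X (G x)) :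
    ContMDiffAt I I.tangent ∞
      (fun y => (⟨y, (mfderiv 𝓘(ℝ, E') I F (G y) (X (G y)) : E)⟩ : TangentBundle I M)) x := by
  have htangentMap : ContMDiffAt 𝓘(ℝ, E').tangent I.tangent ∞ (tangentMapWithin 𝓘(ℝ, E') I F S)
      ⟨G x, X (G x)⟩ :=
    (hF.contMDiffOn_tangentMapWithin (m := ∞) (by simp) hS.uniqueMDiffOn).contMDiffAt
      ((hS.preimage (FiberBundle.continuous_proj E' (TangentSpace 𝓘(ℝ, E')))).mem_nhds hx)
  have hfield : ContMDiffAt I 𝓘(ℝ, E').tangent ∞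
      (fun y => (⟨G y, X (G y)⟩ : TangentBundle 𝓘(ℝ, E') E')) x :=
    (contMDiffAt_vectorSpace_iff_contDiffAt.2 hX).comp x hG
  refine (htangentMap.comp x hfield).congr_of_eventuallyEq ?_
  filter_upwards [hFG, hG.continuousAt.eventually (hS.mem_nhds hx)] with y hy hyS
  simp only [Function.comp_apply, tangentMapWithin, mfderivWithin_of_isOpen hS hyS]
  exact tangentBundle_mk_congr hy.symm _

end Manifold

section ChartDerivative

variable {Q : Type*} [TopologicalSpace Q] [ChartedSpace Plane Q]
  {φ : OpenPartialHomeomorph Q Plane} {q : Q}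

/-- The differential of the chart `φ`, as a linear map of the model plane: in Mathlib the tangent
spaces of `Q` are copies of `Plane`. -/
def chartDeriv (φ : OpenPartialHomeomorph Q Plane) (q : Q) : Plane →L[ℝ] Plane :=
  mfderiv 𝓘(ℝ, Plane) 𝓘(ℝ, Plane) φ q

theorem mdifferentiable_of_mem_maximalAtlas (hφ : φ ∈ IsManifold.maximalAtlas 𝓘(ℝ, Plane) ∞ Q) :
    φ.MDifferentiable 𝓘(ℝ, Plane) 𝓘(ℝ, Plane) :=
  ⟨(contMDiffOn_of_mem_maximalAtlas hφ).mdifferentiableOn (by simp),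
    (contMDiffOn_symm_of_mem_maximalAtlas hφ).mdifferentiableOn (by simp)⟩

theorem isInvertible_chartDeriv (hφ : φ ∈ IsManifold.maximalAtlas 𝓘(ℝ, Plane) ∞ Q)
    (hq : q ∈ φ.source) : (chartDeriv φ q).IsInvertible :=
  ⟨(mdifferentiable_of_mem_maximalAtlas hφ).mfderiv hq, rfl⟩

theorem inverse_chartDeriv (hφ : φ ∈ IsManifold.maximalAtlas 𝓘(ℝ, Plane) ∞ Q)
    (hq : q ∈ φ.source) (u : Plane) :
    (chartDeriv φ q).inverse u = mfderiv 𝓘(ℝ, Plane) 𝓘(ℝ, Plane) φ.symm (φ q) u :=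
  (isInvertible_chartDeriv hφ hq).inverse_apply_eq.2
    (((mdifferentiable_of_mem_maximalAtlas hφ).mfderiv hq).apply_symm_apply u).symm

theorem coordForm_apply (hφ : φ ∈ IsManifold.maximalAtlas 𝓘(ℝ, Plane) ∞ Q)
    (hq : q ∈ φ.source) (i : Fin 2) (u : TangentSpace 𝓘(ℝ, Plane) q) :
    coordForm φ i q u = chartDeriv φ q u i := by
  have hcomp := (EuclideanSpace.proj i : Plane →L[ℝ] ℝ).hasFDerivAt.hasMFDerivAt.comp q
    ((mdifferentiable_of_mem_maximalAtlas hφ).mdifferentiableAt hq).hasMFDerivAt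
  exact DFunLike.congr_fun hcomp.mfderiv u

theorem chartDeriv_coordVector (hφ : φ ∈ IsManifold.maximalAtlas 𝓘(ℝ, Plane) ∞ Q)
    (hq : q ∈ φ.source) (i : Fin 2) :
    chartDeriv φ q (coordVector φ i q) = EuclideanSpace.single i 1 :=
  (isInvertible_chartDeriv hφ hq).self_apply_inverse _

variable [IsManifold 𝓘(ℝ, Plane) ∞ Q]

theorem contMDiffAt_inverse_chartDeriv (hφ : φ ∈ IsManifold.maximalAtlas 𝓘(ℝ, Plane) ∞ Q)
    (hq : q ∈ φ.source) (u : Plane) :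
    ContMDiffAt 𝓘(ℝ, Plane) 𝓘(ℝ, Plane).tangent ∞
      (fun q' => (⟨q', (chartDeriv φ q').inverse u⟩ : TangentBundle 𝓘(ℝ, Plane) Q)) q := by
  refine (contMDiffAt_pushforward φ.open_target (contMDiffOn_symm_of_mem_maximalAtlas hφ)
    (contMDiffAt_of_mem_maximalAtlas hφ hq) (φ.map_source hq) (φ.eventually_left_inverse hq)
    (X := fun _ => u) contDiffAt_const).congr_of_eventuallyEq ?_
  filter_upwards [φ.open_source.mem_nhds hq] with q' hq'
  rw [inverse_chartDeriv hφ hq']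

/-- The derivative at `q` of the change of coordinates from the preferred chart at `x` to `φ`: the
matrix of `chartDeriv φ q` in the trivialization of the tangent bundle around `x`. -/
def transitionDeriv (φ : OpenPartialHomeomorph Q Plane) (x q : Q) : Plane →L[ℝ] Plane :=
  fderiv ℝ (φ ∘ (chartAt Plane x).symm) (chartAt Plane x q)

theorem chartDeriv_symmL (hφ : φ ∈ IsManifold.maximalAtlas 𝓘(ℝ, Plane) ∞ Q)
    {x : Q} (hq : q ∈ φ.source) (hx : q ∈ (chartAt Plane x).source) (u : Plane) :
    chartDeriv φ q ((trivializationAt Plane (TangentSpace 𝓘(ℝ, Plane)) x).symmL ℝ q u) =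
      transitionDeriv φ x q u := by
  set e := chartAt Plane x
  have he := mdifferentiable_of_mem_maximalAtlas
    (IsManifold.chart_mem_maximalAtlas (I := 𝓘(ℝ, Plane)) (n := ∞) x)
  have hφq : MDifferentiableAt 𝓘(ℝ, Plane) 𝓘(ℝ, Plane) φ (e.symm (e q)) := by
    rw [e.left_inv hx]
    exact (mdifferentiable_of_mem_maximalAtlas hφ).mdifferentiableAt hq
  have hcomp := mfderiv_comp_apply (e q) hφq (he.mdifferentiableAt_symm (e.map_source hx)) u
  rw [mfderiv_eq_fderiv, e.left_inv hx] at hcomp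
  rw [TangentBundle.symmL_trivializationAt hx]
  simp only [modelWithCornersSelf_coe, range_id, mfderivWithin_univ]
  exact hcomp.symm

theorem contMDiffAt_transitionDeriv (hφ : φ ∈ IsManifold.maximalAtlas 𝓘(ℝ, Plane) ∞ Q)
    {x : Q} (hq : q ∈ φ.source) (hx : q ∈ (chartAt Plane x).source) :
    ContMDiffAt 𝓘(ℝ, Plane) 𝓘(ℝ, Plane →L[ℝ] Plane) ∞ (transitionDeriv φ x) q := by
  set e := chartAt Plane x
  have he : e ∈ IsManifold.maximalAtlas 𝓘(ℝ, Plane) ∞ Q := IsManifold.chart_mem_maximalAtlas x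
  have htransition : ContMDiffAt 𝓘(ℝ, Plane) 𝓘(ℝ, Plane) ∞ (φ ∘ e.symm) (e q) := by
    refine ContMDiffAt.comp (I' := 𝓘(ℝ, Plane)) _ ?_
      (contMDiffAt_symm_of_mem_maximalAtlas he (e.map_source hx))
    rw [e.left_inv hx]
    exact contMDiffAt_of_mem_maximalAtlas hφ hq
  exact (htransition.contDiffAt.fderiv_right (m := ∞) (by simp)).contMDiffAt.comp q
    (contMDiffAt_of_mem_maximalAtlas he hx)

end ChartDerivative

section CotangentCoordinates

variable {Q : Type*} [TopologicalSpace Q] [ChartedSpace Plane Q]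
  {φ : OpenPartialHomeomorph Q Plane}

theorem eq_innerSL_comp_chartDeriv (hφ : φ ∈ IsManifold.maximalAtlas 𝓘(ℝ, Plane) ∞ Q)
    {q : Q} (hq : q ∈ φ.source) (β : Plane →L[ℝ] ℝ) :
    β = innerSL ℝ (WithLp.toLp 2 fun i => β (coordVector φ i q) : Plane) ∘L chartDeriv φ q := by
  have hbasis (y : Plane) : β ((chartDeriv φ q).inverse y) =
      ⟪(WithLp.toLp 2 fun i => β (coordVector φ i q) : Plane), y⟫_ℝ := by
    conv_lhs => rw [← (EuclideanSpace.basisFun (Fin 2) ℝ).sum_repr y]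
    simp only [EuclideanSpace.basisFun_repr, EuclideanSpace.basisFun_apply, map_sum, map_smul,
      smul_eq_mul, PiLp.inner_apply, RCLike.inner_apply, conj_trivial]
    rfl
  ext u
  rw [← (isInvertible_chartDeriv hφ hq).inverse_apply_self u, hbasis,
    (isInvertible_chartDeriv hφ hq).inverse_apply_self]
  rfl

theorem sum_smul_coordForm (hφ : φ ∈ IsManifold.maximalAtlas 𝓘(ℝ, Plane) ∞ Q)
    {q : Q} (hq : q ∈ φ.source) (p : Plane) :
    ∑ i, p i • coordForm φ i q = innerSL ℝ p ∘L chartDeriv φ q := by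
  refine ContinuousLinearMap.ext fun u => ?_
  have hinner : innerSL ℝ p (chartDeriv φ q u) = ∑ i, p i * chartDeriv φ q u i := by
    simp [PiLp.inner_apply, mul_comm]
  refine Eq.trans ?_ hinner.symm
  simp [coordForm_apply hφ hq]

theorem cotangentCoordSymm_eq (hφ : φ ∈ IsManifold.maximalAtlas 𝓘(ℝ, Plane) ∞ Q)
    {z : Plane × Plane} (hz : z.1 ∈ φ.target) :
    cotangentCoordSymm φ z =
      covector (φ.symm z.1) (innerSL ℝ z.2 ∘L chartDeriv φ (φ.symm z.1)) :=
  congrArg (covector (φ.symm z.1)) (sum_smul_coordForm hφ (φ.map_target hz) z.2)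

theorem cotangentCoord_cotangentCoordSymm (hφ : φ ∈ IsManifold.maximalAtlas 𝓘(ℝ, Plane) ∞ Q)
    {z : Plane × Plane} (hz : z.1 ∈ φ.target) :
    cotangentCoord φ (cotangentCoordSymm φ z) = z := by
  rw [cotangentCoordSymm_eq hφ hz]
  refine Prod.ext (φ.right_inv hz) (PiLp.ext fun i => ?_)
  refine (congrArg (innerSL ℝ z.2) (chartDeriv_coordVector hφ (φ.map_target hz) i)).trans ?_
  simp [EuclideanSpace.inner_single_right]

theorem cotangentCoordSymm_cotangentCoord (hφ : φ ∈ IsManifold.maximalAtlas 𝓘(ℝ, Plane) ∞ Q)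
    {α : CotangentBundle Q} (hα : α.proj ∈ φ.source) :
    cotangentCoordSymm φ (cotangentCoord φ α) = α := by
  obtain ⟨q, β⟩ := α
  rw [cotangentCoordSymm_eq hφ (φ.map_source hα)]
  have hfiber (q' : Q) (hq' : q' = q) :
      covector q' (innerSL ℝ (cotangentCoord φ ⟨q, β⟩).2 ∘L chartDeriv φ q') = ⟨q, β⟩ := by
    subst hq'
    exact congrArg (covector q') (eq_innerSL_comp_chartDeriv hφ hα β).symm
  exact hfiber _ (φ.left_inv hα)

theorem cotangentCoordSymm_zero (x : Plane) :
    cotangentCoordSymm φ (x, 0) = covector (φ.symm x) 0 := by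
  simp [cotangentCoordSymm]

theorem cotangentCoordSymm_map_zero {q : Q} (hq : q ∈ φ.source) :
    cotangentCoordSymm φ (φ q, 0) = covector q 0 := by
  rw [cotangentCoordSymm_zero, φ.left_inv hq]

variable [IsManifold 𝓘(ℝ, Plane) ∞ Q]

theorem contMDiffAt_cotangentCoordSymm (hφ : φ ∈ IsManifold.maximalAtlas 𝓘(ℝ, Plane) ∞ Q)
    {z : Plane × Plane} (hz : z.1 ∈ φ.target) :
    ContMDiffAt 𝓘(ℝ, Plane × Plane) cotangentModel ∞ (cotangentCoordSymm φ) z := by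
  set x := φ.symm z.1
  have hbase : ContMDiffAt 𝓘(ℝ, Plane × Plane) 𝓘(ℝ, Plane) ∞
      (fun z' : Plane × Plane => φ.symm z'.1) z :=
    ContMDiffAt.comp (I' := 𝓘(ℝ, Plane)) z (contMDiffAt_symm_of_mem_maximalAtlas hφ hz)
      contDiff_fst.contMDiff.contMDiffAt
  refine (contMDiffAt_hom_bundle _).2 ⟨hbase, ?_⟩
  have hfiber : ContMDiffAt 𝓘(ℝ, Plane × Plane) 𝓘(ℝ, Plane →L[ℝ] ℝ) ∞
      (fun z' : Plane × Plane => innerSL ℝ z'.2 ∘L transitionDeriv φ x (φ.symm z'.1)) z :=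
    ((innerSL ℝ).contDiff.comp contDiff_snd).contMDiff.contMDiffAt.clm_comp
      (ContMDiffAt.comp (I' := 𝓘(ℝ, Plane)) (g := transitionDeriv φ x) z
        (contMDiffAt_transitionDeriv hφ (φ.map_target hz) (mem_chart_source _ x)) hbase)
  refine hfiber.congr_of_eventuallyEq ?_
  filter_upwards [hbase.continuousAt.eventually ((chartAt Plane x).open_source.mem_nhds
    (mem_chart_source _ x)), continuousAt_fst.eventually (φ.open_target.mem_nhds hz)]
    with z' hz'x hz'
  rw [cotangentCoordSymm_eq hφ hz']
  ext u
  rw [ContinuousLinearMap.comp_apply, ← chartDeriv_symmL hφ (φ.map_target hz') hz'x]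
  simp only [ContinuousLinearMap.inCoordinates, Trivial.fiberBundle_trivializationAt',
    Trivial.continuousLinearMapAt_trivialization, ContinuousLinearMap.id_comp,
    ContinuousLinearMap.comp_apply]
  rfl

theorem contMDiffAt_cotangentCoord (hφ : φ ∈ IsManifold.maximalAtlas 𝓘(ℝ, Plane) ∞ Q)
    {α : CotangentBundle Q} (hα : α.proj ∈ φ.source) :
    ContMDiffAt cotangentModel 𝓘(ℝ, Plane × Plane) ∞ (cotangentCoord φ) α := by
  have hproj : ContMDiffAt cotangentModel 𝓘(ℝ, Plane) ∞
      (fun α : CotangentBundle Q => α.proj) α := contMDiffAt_proj _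
  have hmomentum (i : Fin 2) : ContMDiffAt cotangentModel 𝓘(ℝ, ℝ) ∞
      (fun α : CotangentBundle Q => α.snd (coordVector φ i α.proj)) α :=
    (Bundle.contMDiffAt_totalSpace.1 (ContMDiffAt.clm_bundle_apply (𝕜 := ℝ) (F₁ := Plane)
      (F₂ := ℝ) (E₁ := TangentSpace 𝓘(ℝ, Plane)) (E₂ := fun _ : Q => ℝ)
      (b := fun α : CotangentBundle Q => α.proj) (ϕ := fun α : CotangentBundle Q => α.snd)
      (v := fun α : CotangentBundle Q => coordVector φ i α.proj) (IB := 𝓘(ℝ, Plane))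
      contMDiffAt_id ((contMDiffAt_inverse_chartDeriv hφ hα _).comp α hproj))).2
  exact ((contMDiffAt_of_mem_maximalAtlas hφ hα).comp α hproj).prodMk_space
    ((PiLp.contDiff_toLp (p := 2) (𝕜 := ℝ)).contMDiff.contMDiffAt.comp α
      (contMDiffAt_pi_space.2 hmomentum))

end CotangentCoordinates

theorem inverse_bilin_apply {E : Type*} [NormedAddCommGroup E] [InnerProductSpace ℝ E]
    [CompleteSpace E] {b : E →L[ℝ] E →L[ℝ] ℝ} {D M : E →L[ℝ] E} (hD : D.IsInvertible)
    (hb : ∀ u w, b u w = ⟪M (D u), D w⟫_ℝ) (p : E) :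
    b.inverse (innerSL ℝ p ∘L D) = D.inverse (M.inverse p) := by
  let pullback : E →L[ℝ] E →L[ℝ] ℝ := (ContinuousLinearMap.compL ℝ E E ℝ).flip D ∘L innerSL ℝ
  have hpull (p u : E) : pullback p u = ⟪p, D u⟫_ℝ := rfl
  have hpullback : pullback.IsInvertible := by
    have hinj : Function.Injective pullback := fun p p' h => ext_inner_right ℝ fun u => by
      have hu := DFunLike.congr_fun h (D.inverse u)
      rwa [hpull, hpull, hD.self_apply_inverse] at hu
    have hsurj : Function.Surjective pullback := fun β =>
      ⟨(InnerProductSpace.toDual ℝ E).symm (β ∘L D.inverse), by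
        ext u
        simp [hpull, hD.inverse_apply_self]⟩
    exact ⟨ContinuousLinearEquiv.ofBijective pullback (LinearMap.ker_eq_bot.2 hinj)
      (LinearMap.range_eq_top.2 hsurj), rfl⟩
  have hcomp : b = (pullback ∘L M) ∘L D := by
    ext u w
    exact hb u w
  change b.inverse (pullback p) = _
  rw [hcomp, hD.inverse_comp_apply_of_right, hpullback.inverse_comp_apply_of_left,
    hpullback.inverse_apply_self]

theorem contDiff_bilinearComp_innerSL {E : Type*} [NormedAddCommGroup E]
    [InnerProductSpace ℝ E] [FiniteDimensional ℝ E] :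
    ContDiff ℝ ∞ (fun A : (E →L[ℝ] E) × (E →L[ℝ] E) =>
      (ContinuousLinearMap.bilinearComp (innerSL ℝ : E →L[ℝ] E →L[ℝ] ℝ) A.1 A.2 :
        E →L[ℝ] E →L[ℝ] ℝ)) := by
  refine contDiff_clm_apply_iff.2 fun u => contDiff_clm_apply_iff.2 fun w => ?_
  exact (contDiff_fst.clm_apply contDiff_const).inner ℝ (contDiff_snd.clm_apply contDiff_const)

section Metrics

variable {Q : Type*} [TopologicalSpace Q] [ChartedSpace Plane Q]
  {φ : OpenPartialHomeomorph Q Plane}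
  {g : ∀ q : Q, TangentSpace 𝓘(ℝ, Plane) q →L[ℝ] TangentSpace 𝓘(ℝ, Plane) q →L[ℝ] ℝ}
  {U : Set Q} {S : Set Plane} {B : Plane → Plane →L[ℝ] Plane} {x : Plane} {q : Q}

/-- The metric `g` in the coordinates of the chart `φ`, as an operator on the model plane: its
matrix is `g(∂/∂qⁱ, ∂/∂qʲ)`. -/
def localMetric (φ : OpenPartialHomeomorph Q Plane)
    (g : ∀ q : Q, TangentSpace 𝓘(ℝ, Plane) q →L[ℝ] TangentSpace 𝓘(ℝ, Plane) q →L[ℝ] ℝ)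
    (x : Plane) : Plane →L[ℝ] Plane :=
  InnerProductSpace.continuousLinearMapOfBilin (𝕜 := ℝ)
    (ContinuousLinearMap.bilinearComp (g (φ.symm x) : Plane →L[ℝ] Plane →L[ℝ] ℝ)
      (chartDeriv φ (φ.symm x)).inverse (chartDeriv φ (φ.symm x)).inverse)

/-- The cometric `g♯` in the coordinates of the chart `φ`. -/
def localCometric (φ : OpenPartialHomeomorph Q Plane)
    (g : ∀ q : Q, TangentSpace 𝓘(ℝ, Plane) q →L[ℝ] TangentSpace 𝓘(ℝ, Plane) q →L[ℝ] ℝ)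
    (x : Plane) : Plane →L[ℝ] Plane :=
  (localMetric φ g x).inverse

/-- The metric on the domain of the chart `φ` given in coordinates by the operator field `B`. -/
def coordMetric (φ : OpenPartialHomeomorph Q Plane) (B : Plane → Plane →L[ℝ] Plane) (q : Q) :
    TangentSpace 𝓘(ℝ, Plane) q →L[ℝ] TangentSpace 𝓘(ℝ, Plane) q →L[ℝ] ℝ :=
  ContinuousLinearMap.bilinearComp (innerSL ℝ : Plane →L[ℝ] Plane →L[ℝ] ℝ)
    (B (φ q) ∘L chartDeriv φ q) (chartDeriv φ q)

theorem inner_localMetric (x u w : Plane) :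
    ⟪localMetric φ g x u, w⟫_ℝ =
      g (φ.symm x) ((chartDeriv φ (φ.symm x)).inverse u)
        ((chartDeriv φ (φ.symm x)).inverse w) :=
  InnerProductSpace.continuousLinearMapOfBilin_apply _ u w

theorem coordMetric_apply (q : Q) (u w : Plane) :
    coordMetric φ B q u w = ⟪B (φ q) (chartDeriv φ q u), chartDeriv φ q w⟫_ℝ :=
  rfl

theorem localMetric_coordMetric (hφ : φ ∈ IsManifold.maximalAtlas 𝓘(ℝ, Plane) ∞ Q)
    (hx : x ∈ φ.target) : localMetric φ (coordMetric φ B) x = B x := by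
  have hD := isInvertible_chartDeriv hφ (φ.map_target hx)
  ext1 u
  refine ext_inner_right ℝ fun w => ?_
  rw [inner_localMetric, coordMetric_apply, hD.self_apply_inverse, hD.self_apply_inverse,
    φ.right_inv hx]

theorem localCometric_coordMetric_inverse (hφ : φ ∈ IsManifold.maximalAtlas 𝓘(ℝ, Plane) ∞ Q)
    (hx : x ∈ φ.target) (hB : (B x).IsInvertible) :
    localCometric φ (coordMetric φ fun y => (B y).inverse) x = B x := by
  rw [localCometric, localMetric_coordMetric hφ hx, hB.inverse_inverse]

theorem sharp_comp_chartDeriv (hφ : φ ∈ IsManifold.maximalAtlas 𝓘(ℝ, Plane) ∞ Q)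
    (hx : x ∈ φ.target) (p : Plane) :
    sharp g (φ.symm x) (innerSL ℝ p ∘L chartDeriv φ (φ.symm x)) =
      (chartDeriv φ (φ.symm x)).inverse (localCometric φ g x p) := by
  have hD := isInvertible_chartDeriv hφ (φ.map_target hx)
  refine inverse_bilin_apply hD (b := g (φ.symm x)) (M := localMetric φ g x) (fun u w => ?_) p
  rw [inner_localMetric, hD.inverse_apply_self, hD.inverse_apply_self]
  rfl

theorem cometricCoeff_eq_localCometric (hφ : φ ∈ IsManifold.maximalAtlas 𝓘(ℝ, Plane) ∞ Q)
    (hx : x ∈ φ.target) (i j : Fin 2) :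
    cometricCoeff φ g i j (φ.symm x) = localCometric φ g x (EuclideanSpace.single j 1) i := by
  have hq := φ.map_target hx
  have hform : coordForm φ j (φ.symm x) =
      innerSL ℝ (EuclideanSpace.single j 1 : Plane) ∘L chartDeriv φ (φ.symm x) :=
    ContinuousLinearMap.ext fun u => (coordForm_apply hφ hq j u).trans
      (by
        change _ = ⟪(EuclideanSpace.single j 1 : Plane), chartDeriv φ (φ.symm x) u⟫_ℝ
        simp [EuclideanSpace.inner_single_left])
  refine (coordForm_apply hφ hq i _).trans ?_
  rw [hform]
  refine (congrArg (fun u => chartDeriv φ (φ.symm x) u i)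
    (sharp_comp_chartDeriv hφ hx _)).trans ?_
  rw [(isInvertible_chartDeriv hφ hq).self_apply_inverse]

theorem simpleFunction_cotangentCoordSymm (hφ : φ ∈ IsManifold.maximalAtlas 𝓘(ℝ, Plane) ∞ Q)
    (w : Q → ℝ) {z : Plane × Plane} (hz : z.1 ∈ φ.target) :
    simpleFunction g w (cotangentCoordSymm φ z) =
      simpleEnergy (localCometric φ g) (w ∘ φ.symm) z := by
  rw [cotangentCoordSymm_eq hφ hz]
  have hD := isInvertible_chartDeriv hφ (φ.map_target hz)
  have hkinetic : innerSL ℝ z.2 (chartDeriv φ (φ.symm z.1) (sharp g (φ.symm z.1)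
      (innerSL ℝ z.2 ∘L chartDeriv φ (φ.symm z.1)))) = ⟪z.2, localCometric φ g z.1 z.2⟫_ℝ := by
    refine (congrArg (fun u => innerSL ℝ z.2 (chartDeriv φ (φ.symm z.1) u))
      (sharp_comp_chartDeriv hφ hz _)).trans ?_
    rw [hD.self_apply_inverse, innerSL_apply_apply]
  exact congrArg (fun t => 1 / 2 * t + w (φ.symm z.1)) hkinetic

theorem simpleFunction_coordMetric_inverse (hφ : φ ∈ IsManifold.maximalAtlas 𝓘(ℝ, Plane) ∞ Q)
    (v : Plane → ℝ) {z : Plane × Plane} (hz : z.1 ∈ φ.target) (hB : (B z.1).IsInvertible) :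
    simpleFunction (coordMetric φ fun y => (B y).inverse) (v ∘ φ) (cotangentCoordSymm φ z) =
      simpleEnergy B v z := by
  rw [simpleFunction_cotangentCoordSymm hφ _ hz, simpleEnergy, simpleEnergy,
    localCometric_coordMetric_inverse hφ hz hB, Function.comp_apply, Function.comp_apply,
    φ.right_inv hz]

variable [IsManifold 𝓘(ℝ, Plane) ∞ Q]

theorem IsRiemannianMetricOn.isMetricOperatorOn_localMetric
    (hg : IsRiemannianMetricOn g U) (hφ : φ ∈ IsManifold.maximalAtlas 𝓘(ℝ, Plane) ∞ Q)
    (hU : IsOpen U) : IsMetricOperatorOn (localMetric φ g) (φ.target ∩ φ.symm ⁻¹' U) := by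
  have hpos (x) (hx : x ∈ φ.target ∩ φ.symm ⁻¹' U) (p : Plane) (hp : p ≠ 0) :
      0 < ⟪localMetric φ g x p, p⟫_ℝ := by
    rw [inner_localMetric]
    have hD := isInvertible_chartDeriv hφ (φ.map_target hx.1)
    exact hg.pos _ hx.2 _ ((map_ne_zero_iff _ hD.inverse.injective).2 hp)
  refine ⟨fun x hx p w => ?_, hpos, fun x hx => isInvertible_of_inner_pos (hpos x hx), ?_⟩
  · rw [real_inner_comm _ p, inner_localMetric, inner_localMetric]
    exact hg.symm _ hx.2 _ _
  refine contDiffOn_clm_apply.2 fun u => (contDiffOn_euclidean).2 fun i x hx => ?_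
  have hq := φ.map_target hx.1
  have hentry : ContMDiffAt 𝓘(ℝ, Plane) 𝓘(ℝ, ℝ) ∞ (fun q => g q ((chartDeriv φ q).inverse u)
      ((chartDeriv φ q).inverse (EuclideanSpace.single i 1))) (φ.symm x) :=
    (Bundle.contMDiffAt_totalSpace.1 (ContMDiffAt.clm_bundle_apply₂ (𝕜 := ℝ) (F₁ := Plane)
      (F₂ := Plane) (F₃ := ℝ) (E₁ := TangentSpace 𝓘(ℝ, Plane)) (E₂ := TangentSpace 𝓘(ℝ, Plane))
      (E₃ := fun _ : Q => ℝ) (b := fun q => q) (ψ := g) (IB := 𝓘(ℝ, Plane)) (IM := 𝓘(ℝ, Plane))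
      ((hg.smooth _ hx.2).contMDiffAt (hU.mem_nhds hx.2))
      (contMDiffAt_inverse_chartDeriv hφ hq u) (contMDiffAt_inverse_chartDeriv hφ hq _))).2
  refine ((hentry.comp x (contMDiffAt_symm_of_mem_maximalAtlas hφ hx.1)).contDiffAt
    |>.congr_of_eventuallyEq (.of_forall fun y => ?_)).contDiffWithinAt
  simp [← inner_localMetric, EuclideanSpace.inner_single_right]

theorem isRiemannianMetricOn_coordMetric (hφ : φ ∈ IsManifold.maximalAtlas 𝓘(ℝ, Plane) ∞ Q)
    (hB : IsMetricOperatorOn B S) (hS : IsOpen S) (hU : U ⊆ φ.source) (hUS : MapsTo φ U S) :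
    IsRiemannianMetricOn (coordMetric φ B) U where
  symm q hq u w :=
    (hB.symm _ (hUS hq) _ _).trans (real_inner_comm _ _)
  pos q hq u hu :=
    hB.pos _ (hUS hq) _ ((map_ne_zero_iff _ (isInvertible_chartDeriv hφ (hU hq)).injective).2 hu)
  smooth q hq := by
    refine ((contMDiffAt_hom_bundle _).2 ⟨contMDiffAt_id, ?_⟩).contMDiffWithinAt
    have hT := contMDiffAt_transitionDeriv hφ (hU hq) (mem_chart_source _ q)
    have hBφ : ContMDiffAt 𝓘(ℝ, Plane) 𝓘(ℝ, Plane →L[ℝ] Plane) ∞ (fun q' => B (φ q')) q :=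
      (hB.smooth.contDiffAt (hS.mem_nhds (hUS hq))).contMDiffAt.comp q
        (contMDiffAt_of_mem_maximalAtlas hφ (hU hq))
    have hcoord := contDiff_bilinearComp_innerSL.comp_contMDiffAt
      (f := fun q' => (B (φ q') ∘L transitionDeriv φ q q', transitionDeriv φ q q'))
      ((hBφ.clm_comp hT).prodMk_space hT)
    refine hcoord.congr_of_eventuallyEq ?_
    filter_upwards [φ.open_source.mem_nhds (hU hq),
      (chartAt Plane q).open_source.mem_nhds (mem_chart_source _ q)] with q' hq' hx
    ext u w
    refine (inCoordinates_apply_eq₂ (F₁ := Plane) (F₂ := Plane) (F₃ := ℝ)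
        (E₁ := TangentSpace 𝓘(ℝ, Plane)) (E₂ := TangentSpace 𝓘(ℝ, Plane))
        (E₃ := fun _ : Q => ℝ) hx hx (mem_univ _)).trans ?_
    have htriv (c : ℝ) : (trivializationAt ℝ (fun _ : Q => ℝ) q).linearMapAt ℝ q' c = c := by
      simp
    refine (htriv _).trans ?_
    rw [← Trivialization.symmL_apply (R := ℝ) _ hx, ← Trivialization.symmL_apply (R := ℝ) _ hx]
    refine (coordMetric_apply q' _ _).trans ?_
    rw [chartDeriv_symmL hφ hq' hx, chartDeriv_symmL hφ hq' hx]
    rfl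

end Metrics

section CotangentDynamics

variable {Q : Type*} [TopologicalSpace Q] [ChartedSpace Plane Q] [IsManifold 𝓘(ℝ, Plane) ∞ Q]
  {φ : OpenPartialHomeomorph Q Plane} {V : CotangentBundle Q → ℝ} {z : Plane × Plane}

/-- The derivative of the canonical coordinates `(x, p)`: it sends the coordinate expression of a
vector tangent to `T*Q` to that vector. -/
def cotangentDeriv (φ : OpenPartialHomeomorph Q Plane) (z : Plane × Plane) :
    Plane × Plane →L[ℝ] Plane × (Plane →L[ℝ] ℝ) :=
  mfderiv 𝓘(ℝ, Plane × Plane) cotangentModel (cotangentCoordSymm φ) z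

theorem hasMFDerivAt_cotangentCoordSymm (hφ : φ ∈ IsManifold.maximalAtlas 𝓘(ℝ, Plane) ∞ Q)
    (hz : z.1 ∈ φ.target) :
    HasMFDerivAt 𝓘(ℝ, Plane × Plane) cotangentModel (cotangentCoordSymm φ) z
      (cotangentDeriv φ z) :=
  ((contMDiffAt_cotangentCoordSymm hφ hz).mdifferentiableAt (by simp)).hasMFDerivAt

theorem hamiltonianField_cotangentCoordSymm
    (hφ : φ ∈ IsManifold.maximalAtlas 𝓘(ℝ, Plane) ∞ Q) (H : CotangentBundle Q → ℝ)
    (hz : z.1 ∈ φ.target) :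
    hamiltonianField φ H (cotangentCoordSymm φ z) =
      cotangentDeriv φ z (symplecticGradient (H ∘ cotangentCoordSymm φ) z) := by
  have hcoord (K : Plane × Plane → ℝ) : symplecticGradient K z =
      (WithLp.toLp 2 fun i => fderiv ℝ K z (0, EuclideanSpace.single i 1),
        WithLp.toLp 2 fun i => -fderiv ℝ K z (EuclideanSpace.single i 1, 0)) := by
    ext i
    · simp [← inner_symplecticGradient_fst, EuclideanSpace.inner_single_right]
    · simp [← inner_symplecticGradient_snd, EuclideanSpace.inner_single_right]
  rw [hcoord]
  unfold hamiltonianField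
  rw [cotangentCoord_cotangentCoordSymm hφ hz]
  rfl

theorem vlift_cotangentCoordSymm (hφ : φ ∈ IsManifold.maximalAtlas 𝓘(ℝ, Plane) ∞ Q)
    (hz : z.1 ∈ φ.target) (b : Plane) :
    vlift (cotangentCoordSymm φ z) (innerSL ℝ b ∘L chartDeriv φ (φ.symm z.1)) =
      cotangentDeriv φ z (0, b) := by
  let β : TangentSpace 𝓘(ℝ, Plane) (φ.symm z.1) →L[ℝ] ℝ :=
    innerSL ℝ b ∘L chartDeriv φ (φ.symm z.1)
  have hcurve (t : ℝ) : covector (φ.symm z.1)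
      (∑ i, z.2 i • coordForm φ i (φ.symm z.1) + t • β) =
      cotangentCoordSymm φ (z + t • ((0, b) : Plane × Plane)) := by
    rw [sum_smul_coordForm hφ (φ.map_target hz),
      show z + t • ((0, b) : Plane × Plane) = (z.1, z.2 + t • b) by ext <;> simp]
    refine Eq.trans ?_ (cotangentCoordSymm_eq (z := (z.1, z.2 + t • b)) hφ hz).symm
    refine congrArg (covector (φ.symm z.1)) (ContinuousLinearMap.ext fun u => ?_)
    have hinner := inner_add_left (𝕜 := ℝ) z.2 (t • b) (chartDeriv φ (φ.symm z.1) u)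
    rw [real_inner_smul_left] at hinner
    exact hinner.symm
  have hline : HasMFDerivAt 𝓘(ℝ, ℝ) 𝓘(ℝ, Plane × Plane)
      (fun t : ℝ => z + t • ((0, b) : Plane × Plane)) 0
      ((1 : ℝ →L[ℝ] ℝ).smulRight ((0, b) : Plane × Plane)) :=
    (((1 : ℝ →L[ℝ] ℝ).smulRight ((0, b) : Plane × Plane)).hasFDerivAt.const_add z).hasMFDerivAt
  have hderiv := hasMFDerivAt_cotangentCoordSymm hφ hz
  rw [show z = z + (0 : ℝ) • ((0, b) : Plane × Plane) by simp] at hderiv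
  refine (congrArg (fun γ : ℝ → CotangentBundle Q =>
    (mfderiv 𝓘(ℝ, ℝ) cotangentModel γ 0 (1 : ℝ) : Plane × (Plane →L[ℝ] ℝ)))
    (funext hcurve)).trans ?_
  refine (DFunLike.congr_fun (hderiv.comp 0 hline).mfderiv (1 : ℝ)).trans ?_
  change cotangentDeriv φ (z + (0 : ℝ) • ((0, b) : Plane × Plane))
    ((1 : ℝ) • ((0, b) : Plane × Plane)) = _
  rw [zero_smul, add_zero, one_smul]

theorem cotangentDeriv_injective (hφ : φ ∈ IsManifold.maximalAtlas 𝓘(ℝ, Plane) ∞ Q)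
    (hz : z.1 ∈ φ.target) : Function.Injective (cotangentDeriv φ z) := by
  have hcoord : MDifferentiableAt cotangentModel 𝓘(ℝ, Plane × Plane) (cotangentCoord φ)
      (cotangentCoordSymm φ z) :=
    (contMDiffAt_cotangentCoord hφ (φ.map_target hz)).mdifferentiableAt (by simp)
  have hid : HasMFDerivAt 𝓘(ℝ, Plane × Plane) 𝓘(ℝ, Plane × Plane)
      (cotangentCoord φ ∘ cotangentCoordSymm φ) z (ContinuousLinearMap.id ℝ (Plane × Plane)) := by
    refine (hasMFDerivAt_id z).congr_of_eventuallyEq ?_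
    filter_upwards [continuousAt_fst.eventually (φ.open_target.mem_nhds hz)] with z' hz'
    exact cotangentCoord_cotangentCoordSymm hφ hz'
  have hcomp := hasMFDerivAt_unique
    (hcoord.hasMFDerivAt.comp z (hasMFDerivAt_cotangentCoordSymm hφ hz)) hid
  exact (show Function.LeftInverse
    (mfderiv cotangentModel 𝓘(ℝ, Plane × Plane) (cotangentCoord φ) (cotangentCoordSymm φ z))
    (cotangentDeriv φ z) from DFunLike.congr_fun hcomp).injective

theorem differential_cotangentDeriv (hφ : φ ∈ IsManifold.maximalAtlas 𝓘(ℝ, Plane) ∞ Q)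
    (hz : z.1 ∈ φ.target)
    (hV : MDifferentiableAt cotangentModel 𝓘(ℝ, ℝ) V (cotangentCoordSymm φ z))
    (X : Plane × Plane) :
    differential cotangentModel V (cotangentCoordSymm φ z) (cotangentDeriv φ z X) =
      fderiv ℝ (V ∘ cotangentCoordSymm φ) z X := by
  have hcomp : HasFDerivAt (𝕜 := ℝ) (V ∘ cotangentCoordSymm φ)
      (_ : Plane × Plane →L[ℝ] ℝ) z :=
    (hV.hasMFDerivAt.comp z (hasMFDerivAt_cotangentCoordSymm hφ hz)).hasFDerivAt
  exact (DFunLike.congr_fun hcomp.fderiv X).symm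

theorem contMDiffAt_of_contDiffAt_comp_cotangentCoordSymm
    (hφ : φ ∈ IsManifold.maximalAtlas 𝓘(ℝ, Plane) ∞ Q) (hz : z.1 ∈ φ.target)
    (hV : ContDiffAt ℝ ∞ (V ∘ cotangentCoordSymm φ) z) :
    ContMDiffAt cotangentModel 𝓘(ℝ, ℝ) ∞ V (cotangentCoordSymm φ z) := by
  have hsource : (cotangentCoordSymm φ z).proj ∈ φ.source := φ.map_target hz
  have hV' : ContMDiffAt 𝓘(ℝ, Plane × Plane) 𝓘(ℝ, ℝ) ∞ (V ∘ cotangentCoordSymm φ)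
      (cotangentCoord φ (cotangentCoordSymm φ z)) := by
    rw [cotangentCoord_cotangentCoordSymm hφ hz]
    exact hV.contMDiffAt
  refine (hV'.comp _ (contMDiffAt_cotangentCoord hφ hsource)).congr_of_eventuallyEq ?_
  have hproj : Continuous (fun α : CotangentBundle Q => α.proj) :=
    FiberBundle.continuous_proj _ _
  filter_upwards [hproj.continuousAt.eventually (φ.open_source.mem_nhds hsource)] with α hα
  exact congrArg V (cotangentCoordSymm_cotangentCoord hφ hα).symm

theorem mem_actuation_cotangentCoordSymm_iff
    (hφ : φ ∈ IsManifold.maximalAtlas 𝓘(ℝ, Plane) ∞ Q)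
    {ξ : ∀ q : Q, TangentSpace 𝓘(ℝ, Plane) q →L[ℝ] ℝ} (hξ : IsAdapted φ ξ)
    (hz : z.1 ∈ φ.target) (X : TangentSpace cotangentModel (cotangentCoordSymm φ z)) :
    X ∈ actuation ξ (cotangentCoordSymm φ z) ↔
      ∃ t : ℝ, X = cotangentDeriv φ z (0, EuclideanSpace.single 1 t) := by
  have hq : φ.symm z.1 ∈ φ.source := φ.map_target hz
  obtain ⟨c, hc⟩ := Submodule.span_singleton_eq_span_singleton.1 (hξ _ hq).symm
  have hform : ξ (φ.symm z.1) =
      innerSL ℝ (EuclideanSpace.single 1 (c : ℝ) : Plane) ∘L chartDeriv φ (φ.symm z.1) := by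
    refine ContinuousLinearMap.ext fun u => ?_
    change _ = ⟪(EuclideanSpace.single 1 (c : ℝ) : Plane), chartDeriv φ (φ.symm z.1) u⟫_ℝ
    simp [← hc, coordForm_apply hφ hq, EuclideanSpace.inner_single_left, Units.smul_def]
  have hlift : vlift (cotangentCoordSymm φ z) (ξ (cotangentCoordSymm φ z).proj) =
      cotangentDeriv φ z (0, EuclideanSpace.single 1 (c : ℝ)) :=
    (congrArg (vlift (cotangentCoordSymm φ z)) hform).trans (vlift_cotangentCoordSymm hφ hz _)
  have hsmul (t : ℝ) : t • cotangentDeriv φ z (0, EuclideanSpace.single 1 (c : ℝ)) =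
      cotangentDeriv φ z (0, EuclideanSpace.single 1 (t * c)) := by
    rw [← map_smul]
    congr 1
    ext i
    · simp
    · fin_cases i <;> simp
  rw [actuation, Submodule.mem_span_singleton, hlift]
  constructor
  · rintro ⟨t, rfl⟩
    exact ⟨t * c, hsmul t⟩
  · rintro ⟨t, rfl⟩
    exact ⟨t / c, (hsmul _).trans (by rw [div_mul_cancel₀ t c.ne_zero])⟩

end CotangentDynamics

section Matching

variable {E : Type*} [NormedAddCommGroup E] [InnerProductSpace ℝ E]

/-- The polarized kinetic part of the rate of change of `½ ⟨p, F p⟩ + v` along the Hamiltonian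
vector field of `½ ⟨p, A p⟩ + h`. -/
def kineticRate (A F : E → E →L[ℝ] E) (x p q w : E) : ℝ :=
  ⟪p, fderiv ℝ F x (A x w) q⟫_ℝ - ⟪p, fderiv ℝ A x (F x w) q⟫_ℝ

/-- The potential part of the rate of change of `½ ⟨p, F p⟩ + v` along the Hamiltonian vector
field of `½ ⟨p, A p⟩ + h`. -/
def potentialRate (A : E → E →L[ℝ] E) (h : E → ℝ) (F : E → E →L[ℝ] E) (v : E → ℝ)
    (x w : E) : ℝ :=
  fderiv ℝ v x (A x w) - fderiv ℝ h x (F x w)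

/-- The intensity of the force in the direction `n` that keeps `½ ⟨p, F p⟩ + v` constant along the
motion with Hamiltonian `½ ⟨p, A p⟩ + h`, when `p - q` is parallel to `n` and `q` is matched. -/
def matchingForce (A : E → E →L[ℝ] E) (h : E → ℝ) (F : E → E →L[ℝ] E) (v : E → ℝ)
    (n x p q : E) : ℝ :=
  -(1 / 2 * (kineticRate A F x n p p + kineticRate A F x q n p + kineticRate A F x q q n) +
    potentialRate A h F v x n)

variable {A F : E → E →L[ℝ] E} {h v : E → ℝ} {x : E}

theorem kineticRate_add_smul (q n : E) (s : ℝ) :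
    kineticRate A F x (q + s • n) (q + s • n) (q + s • n) = kineticRate A F x q q q +
      s * (kineticRate A F x n (q + s • n) (q + s • n) + kineticRate A F x q n (q + s • n) +
        kineticRate A F x q q n) := by
  simp only [kineticRate, map_add, map_smul, add_apply, smul_apply, inner_add_left,
    inner_add_right, real_inner_smul_left, real_inner_smul_right]
  ring

theorem potentialRate_add_smul (q n : E) (s : ℝ) :
    potentialRate A h F v x (q + s • n) =
      potentialRate A h F v x q + s * potentialRate A h F v x n := by
  simp only [potentialRate, map_add, map_smul, smul_eq_mul]
  ring

theorem kineticRate_smul (q : E) (s : ℝ) :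
    kineticRate A F x (s • q) (s • q) (s • q) = s ^ 3 * kineticRate A F x q q q := by
  simp only [kineticRate, map_smul, smul_apply, real_inner_smul_left, real_inner_smul_right]
  ring

theorem potentialRate_smul (q : E) (s : ℝ) :
    potentialRate A h F v x (s • q) = s * potentialRate A h F v x q := by
  simp only [potentialRate, map_smul, smul_eq_mul]
  ring

theorem matchingForce_zero (hh : fderiv ℝ h x = 0) (hv : fderiv ℝ v x = 0) (n : E) :
    matchingForce A h F v n x 0 0 = 0 := by
  simp [matchingForce, kineticRate, potentialRate, hh, hv]

theorem contDiffAt_matchingForce (hA : ContDiffAt ℝ ∞ A x) (hh : ContDiffAt ℝ ∞ h x)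
    (hF : ContDiffAt ℝ ∞ F x) (hv : ContDiffAt ℝ ∞ v x) (n p : E) {q : E × E → E}
    (hq : ContDiffAt ℝ ∞ q (x, p)) :
    ContDiffAt ℝ ∞ (fun z : E × E => matchingForce A h F v n z.1 z.2 (q z)) (x, p) := by
  have base {G : Type _} [NormedAddCommGroup G] [NormedSpace ℝ G] {f : E → G}
      (hf : ContDiffAt ℝ ∞ f x) : ContDiffAt ℝ ∞ (fun z : E × E => f z.1) (x, p) :=
    hf.comp (x, p) contDiffAt_fst
  have hDA := base (hA.fderiv_right (m := ∞) (by simp))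
  have hDF := base (hF.fderiv_right (m := ∞) (by simp))
  have kinetic {a b c : E × E → E} (ha : ContDiffAt ℝ ∞ a (x, p))
      (hb : ContDiffAt ℝ ∞ b (x, p)) (hc : ContDiffAt ℝ ∞ c (x, p)) :
      ContDiffAt ℝ ∞ (fun z => kineticRate A F z.1 (a z) (b z) (c z)) (x, p) :=
    (ha.inner ℝ ((hDF.clm_apply ((base hA).clm_apply hc)).clm_apply hb)).sub
      (ha.inner ℝ ((hDA.clm_apply ((base hF).clm_apply hc)).clm_apply hb))
  have potential : ContDiffAt ℝ ∞ (fun z => potentialRate A h F v z.1 n) (x, p) :=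
    ((base (hv.fderiv_right (m := ∞) (by simp))).clm_apply
      ((base hA).clm_apply contDiffAt_const)).sub
    ((base (hh.fderiv_right (m := ∞) (by simp))).clm_apply
      ((base hF).clm_apply contDiffAt_const))
  exact ((contDiffAt_const.mul (((kinetic contDiffAt_const contDiffAt_snd contDiffAt_snd).add
    (kinetic hq contDiffAt_const contDiffAt_snd)).add
      (kinetic hq hq contDiffAt_const))).add potential).neg

theorem fderiv_simpleEnergy_matchingForce [CompleteSpace E] (hA : DifferentiableAt ℝ A x)
    (hA_symm : ∀ p q, ⟪A x p, q⟫_ℝ = ⟪p, A x q⟫_ℝ) (hh : DifferentiableAt ℝ h x)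
    (hF : DifferentiableAt ℝ F x) (hF_symm : ∀ p q, ⟪F x p, q⟫_ℝ = ⟪p, F x q⟫_ℝ)
    (hv : DifferentiableAt ℝ v x) {p q n : E} (hp : q + ⟪F x p, n⟫_ℝ • n = p)
    (hkin : kineticRate A F x q q q = 0) (hpot : potentialRate A h F v x q = 0) :
    fderiv ℝ (simpleEnergy F v) (x, p) (symplecticGradient (simpleEnergy A h) (x, p) +
      (0, matchingForce A h F v n x p q • n)) = 0 := by
  have hkin_p := kineticRate_add_smul (A := A) (F := F) (x := x) q n ⟪F x p, n⟫_ℝ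
  have hpot_p := potentialRate_add_smul (A := A) (h := h) (F := F) (v := v) (x := x) q n
    ⟪F x p, n⟫_ℝ
  rw [hp, hkin] at hkin_p
  rw [hp, hpot] at hpot_p
  rw [fderiv_simpleEnergy_symplecticGradient hA hA_symm hh hF hF_symm hv, real_inner_smul_right]
  change 1 / 2 * kineticRate A F x p p p + potentialRate A h F v x p + _ = 0
  rw [hkin_p, hpot_p, matchingForce]
  ring

end Matching

section PlaneMatching

/-- The cometric `c p₀² + (p₁ - r p₀)²` of the plane, as an operator. -/
def shearedCometric (c r : ℝ) : Plane →L[ℝ] Plane :=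
  c • (innerSL ℝ (EuclideanSpace.single 0 1)).smulRight (EuclideanSpace.single 0 1) +
    (innerSL ℝ (EuclideanSpace.single 1 1 - r • EuclideanSpace.single 0 1)).smulRight
      (EuclideanSpace.single 1 1 - r • EuclideanSpace.single 0 1)

theorem inner_shearedCometric (c r : ℝ) (p q : Plane) :
    ⟪shearedCometric c r p, q⟫_ℝ = c * p 0 * q 0 + (p 1 - r * p 0) * (q 1 - r * q 0) := by
  simp [shearedCometric, inner_add_left, inner_sub_left, real_inner_smul_left,
    EuclideanSpace.inner_single_left]
  ring

theorem shearedCometric_slope (c r : ℝ) :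
    shearedCometric c r (EuclideanSpace.single 0 1 + r • EuclideanSpace.single 1 1) =
      c • EuclideanSpace.single 0 1 :=
  ext_inner_right ℝ fun q => by
    simp [inner_shearedCometric, real_inner_smul_left, EuclideanSpace.inner_single_left,
      -map_add, -map_smul]

theorem slope_add_inner_shearedCometric (c r : ℝ) (p : Plane) :
    p 0 • (EuclideanSpace.single 0 1 + r • EuclideanSpace.single 1 1) +
      ⟪shearedCometric c r p, EuclideanSpace.single 1 1⟫_ℝ • EuclideanSpace.single 1 1 = p := by
  ext i
  fin_cases i <;> simp [inner_shearedCometric, mul_comm]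

theorem contDiff_shearedCometric :
    ContDiff ℝ ∞ fun a : ℝ × ℝ => shearedCometric a.1 a.2 := by
  have hn : ContDiff ℝ ∞ (fun a : ℝ × ℝ =>
      (EuclideanSpace.single 1 1 - a.2 • EuclideanSpace.single 0 1 : Plane)) :=
    contDiff_const.sub (contDiff_snd.smul contDiff_const)
  exact (contDiff_fst.smul contDiff_const).add (((innerSL ℝ).contDiff.comp hn).smulRight hn)

theorem isMetricOperatorOn_shearedCometric {c r : Plane → ℝ} {S : Set Plane}
    (hc : ContDiffOn ℝ ∞ c S) (hc_pos : ∀ x ∈ S, 0 < c x) (hr : ContDiffOn ℝ ∞ r S) :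
    IsMetricOperatorOn (fun x => shearedCometric (c x) (r x)) S := by
  have hpos (x) (hx : x ∈ S) (p : Plane) (hp : p ≠ 0) :
      0 < ⟪shearedCometric (c x) (r x) p, p⟫_ℝ := by
    have hcx := hc_pos x hx
    rw [inner_shearedCometric]
    by_cases hp₀ : p 0 = 0
    · have hp₁ : p 1 ≠ 0 := fun hp₁ => hp (by ext i; fin_cases i <;> simp [hp₀, hp₁])
      rw [hp₀]
      nlinarith [sq_pos_of_ne_zero hp₁]
    · nlinarith [mul_pos hcx (sq_pos_of_ne_zero hp₀), sq_nonneg (p 1 - r x * p 0)]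
  refine ⟨fun x _ p q => ?_, hpos, fun x hx => isInvertible_of_inner_pos (hpos x hx), ?_⟩
  · rw [inner_shearedCometric, real_inner_comm, inner_shearedCometric]
    ring
  · exact contDiff_shearedCometric.comp_contDiffOn (hc.prodMk hr)

theorem inner_fderiv_shearedCometric_slope {c r : Plane → ℝ} {x : Plane}
    (hc : DifferentiableAt ℝ c x) (hr : DifferentiableAt ℝ r x) (u : Plane) :
    ⟪(EuclideanSpace.single 0 1 + r x • EuclideanSpace.single 1 1 : Plane),
      fderiv ℝ (fun y => shearedCometric (c y) (r y)) x u
        (EuclideanSpace.single 0 1 + r x • EuclideanSpace.single 1 1)⟫_ℝ = fderiv ℝ c x u := by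
  set e : Plane := EuclideanSpace.single 0 1 + r x • EuclideanSpace.single 1 1 with he
  have hF : DifferentiableAt ℝ (fun y => shearedCometric (c y) (r y)) x :=
    (contDiff_shearedCometric.differentiable (by simp)).differentiableAt.comp x (hc.prodMk hr)
  have hdiag (y : Plane) : ⟪e, shearedCometric (c y) (r y) e⟫_ℝ = c y + (r x - r y) ^ 2 := by
    rw [real_inner_comm, inner_shearedCometric]
    simp [he, sq]
  have hinner := (innerSL ℝ e).hasFDerivAt.comp x (hF.hasFDerivAt.clm_apply (hasFDerivAt_const e x))
  have hsum := hc.hasFDerivAt.add (((hasFDerivAt_const (r x) x).sub hr.hasFDerivAt).pow 2)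
  simpa using DFunLike.congr_fun
    (hinner.unique (hsum.congr_of_eventuallyEq (.of_forall hdiag))) u

theorem exists_pos_fderiv_apply_eq_mul {E : Type*} [NormedAddCommGroup E] [NormedSpace ℝ E]
    [FiniteDimensional ℝ E] {g : E → ℝ} {x₀ n : E}
    (hg : ∀ᶠ x in 𝓝 x₀, ContDiffAt ℝ ∞ g x) (hn : n ≠ 0) :
    ∃ c : E → ℝ, ContDiff ℝ ∞ c ∧ (∀ x, 0 < c x) ∧ ∀ᶠ x in 𝓝 x₀, fderiv ℝ c x n = c x * g x := by
  have : ProperSpace E := FiniteDimensional.proper ℝ E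
  obtain ⟨ℓ, hℓ⟩ := SeparatingDual.exists_eq_one (R := ℝ) hn
  obtain ⟨g', hg', hgg'⟩ := exists_contDiff_eventuallyEq hg
  obtain ⟨f, hf, hfn, -⟩ := exists_fderiv_apply_eq hg' hℓ x₀
  refine ⟨fun x => Real.exp (f x), hf.exp, fun x => Real.exp_pos _, ?_⟩
  filter_upwards [hgg'] with x hx
  rw [fderiv_exp (hf.differentiable (by simp) x), ← hx, ← hfn]
  simp

theorem exists_fderiv_apply_eq_mul_fderiv_apply {E : Type*} [NormedAddCommGroup E]
    [InnerProductSpace ℝ E] [FiniteDimensional ℝ E] {k h : E → ℝ} {x₀ n e : E}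
    (hk : ∀ᶠ x in 𝓝 x₀, ContDiffAt ℝ ∞ k x) (hk_pos : 0 < k x₀)
    (hh : ∀ᶠ x in 𝓝 x₀, ContDiffAt ℝ ∞ h x) (hh₀ : fderiv ℝ h x₀ = 0)
    (hhn : 0 < fderiv ℝ (fderiv ℝ h) x₀ n e) :
    ∃ v : E → ℝ, (ContDiff ℝ ∞ v ∧ v x₀ = 0 ∧ fderiv ℝ v x₀ = 0 ∧
        ∀ u, u ≠ 0 → 0 < fderiv ℝ (fderiv ℝ v) x₀ u u) ∧
      ∀ᶠ x in 𝓝 x₀, fderiv ℝ v x n = k x * fderiv ℝ h x e := by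
  have : ProperSpace E := FiniteDimensional.proper ℝ E
  have hhe : ∀ᶠ x in 𝓝 x₀, ContDiffAt ℝ ∞ (fun x => fderiv ℝ h x e) x :=
    hh.mono fun x hx => (hx.fderiv_right (m := ∞) (by simp)).clm_apply contDiffAt_const
  obtain ⟨G, hG, hGh⟩ := exists_contDiff_eventuallyEq
    (hk.mp (hhe.mono fun x hhx hkx => hkx.mul hhx))
  have hG₀ : G x₀ = 0 := by simp [hGh.self_of_nhds, hh₀]
  have hGn : fderiv ℝ G x₀ n = k x₀ * fderiv ℝ (fderiv ℝ h) x₀ n e := by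
    rw [hGh.fderiv_eq, fderiv_fun_mul (hk.self_of_nhds.differentiableAt (by simp))
      (hhe.self_of_nhds.differentiableAt (by simp)), hh₀]
    simp [fderiv_fderiv_apply hh.self_of_nhds]
  obtain ⟨v, hv, hvn, hv₀⟩ := exists_fderiv_apply_eq_of_fderiv_pos hG hG₀
    (hGn ▸ mul_pos hk_pos hhn)
  exact ⟨v, ⟨hv, hv₀⟩, hGh.mono fun x hx => (hvn x).trans hx⟩

/-- The ratio `p₁ / p₀` of the momentum `p` whose velocity under the cometric `A` is `ν`. -/
def momentumSlope (A : Plane → Plane →L[ℝ] Plane) (ν x : Plane) : ℝ :=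
  (A x).inverse ν 1 / (A x).inverse ν 0

variable {A : Plane → Plane →L[ℝ] Plane} {S : Set Plane} {h c v : Plane → ℝ} {x ν : Plane}

theorem inverse_apply_eq_smul_momentumSlope (hν : (A x).inverse ν 0 ≠ 0) :
    (A x).inverse ν = (A x).inverse ν 0 •
      (EuclideanSpace.single 0 1 + momentumSlope A ν x • EuclideanSpace.single 1 1) := by
  ext i
  fin_cases i <;> simp [momentumSlope, mul_div_cancel₀, hν]

theorem apply_momentumSlope (hA : (A x).IsInvertible) (hν : (A x).inverse ν 0 ≠ 0) :
    A x (EuclideanSpace.single 0 1 + momentumSlope A ν x • EuclideanSpace.single 1 1) =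
      ((A x).inverse ν 0)⁻¹ • ν := by
  rw [eq_inv_smul_iff₀ hν, ← map_smul, ← inverse_apply_eq_smul_momentumSlope hν,
    hA.self_apply_inverse]

theorem contDiffAt_momentumSlope (hA : IsMetricOperatorOn A S) (hS : S ∈ 𝓝 x)
    (hν : (A x).inverse ν 0 ≠ 0) : ContDiffAt ℝ ∞ (momentumSlope A ν) x := by
  have hM (i : Fin 2) : ContDiffAt ℝ ∞ (fun y => (A y).inverse ν i) x :=
    contDiffAt_euclidean.1 ((hA.inverse.smooth.contDiffAt hS).clm_apply contDiffAt_const) i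
  exact (hM 1).div (hM 0) hν

theorem kineticRate_momentumSlope (hA : IsMetricOperatorOn A S) (hS : S ∈ 𝓝 x)
    (hν : (A x).inverse ν 0 ≠ 0) (hc : DifferentiableAt ℝ c x) :
    kineticRate A (fun y => shearedCometric (c y) (momentumSlope A ν y)) x
      (EuclideanSpace.single 0 1 + momentumSlope A ν x • EuclideanSpace.single 1 1)
      (EuclideanSpace.single 0 1 + momentumSlope A ν x • EuclideanSpace.single 1 1)
      (EuclideanSpace.single 0 1 + momentumSlope A ν x • EuclideanSpace.single 1 1) =
    ((A x).inverse ν 0)⁻¹ * (fderiv ℝ c x ν + c x * (((A x).inverse ν 0)⁻¹ *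
      ⟪ν, fderiv ℝ (fun y => (A y).inverse) x (EuclideanSpace.single 0 1) ν⟫_ℝ)) := by
  set e : Plane := EuclideanSpace.single 0 1 + momentumSlope A ν x • EuclideanSpace.single 1 1
  have hx := mem_of_mem_nhds hS
  have hr := (contDiffAt_momentumSlope hA hS hν).differentiableAt (by simp)
  have hM := inner_fderiv_apply_of_apply_eq (n := ν) (u := EuclideanSpace.single 0 1)
    ((hA.smooth.contDiffAt hS).differentiableAt (by simp)) (hA.symm x hx)
    ((hA.inverse.smooth.contDiffAt hS).differentiableAt (by simp))
    (by filter_upwards [hS] with y hy using (hA.isInvertible y hy).self_apply_inverse ν)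
  rw [inverse_apply_eq_smul_momentumSlope hν, map_smul, real_inner_smul_left,
    real_inner_smul_right] at hM
  rw [kineticRate, apply_momentumSlope (hA.isInvertible x hx) hν, shearedCometric_slope,
    inner_fderiv_shearedCometric_slope hc hr, map_smul, map_smul, smul_apply,
    real_inner_smul_right, ← neg_eq_iff_eq_neg.2 hM]
  linear_combination c x * ⟪e, fderiv ℝ A x (EuclideanSpace.single 0 1) e⟫_ℝ *
    (((A x).inverse ν 0)⁻¹ * (A x).inverse ν 0 + 1) * inv_mul_cancel₀ hν

theorem potentialRate_momentumSlope (hA : (A x).IsInvertible) (hν : (A x).inverse ν 0 ≠ 0) :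
    potentialRate A h (fun y => shearedCometric (c y) (momentumSlope A ν y)) v x
      (EuclideanSpace.single 0 1 + momentumSlope A ν x • EuclideanSpace.single 1 1) =
    ((A x).inverse ν 0)⁻¹ * fderiv ℝ v x ν -
      c x * fderiv ℝ h x (EuclideanSpace.single 0 1) := by
  rw [potentialRate, apply_momentumSlope hA hν, shearedCometric_slope, map_smul, map_smul,
    smul_eq_mul, smul_eq_mul]

theorem exists_matching {x₀ : Plane} (hA : IsMetricOperatorOn A S) (hS : S ∈ 𝓝 x₀)
    (hh : ∀ᶠ x in 𝓝 x₀, ContDiffAt ℝ ∞ h x) (hh₀ : fderiv ℝ h x₀ = 0) {w : Plane} (hw : 0 < w 0)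
    (hhw : 0 < fderiv ℝ (fderiv ℝ h) x₀ (A x₀ w) (EuclideanSpace.single 0 1)) :
    ∃ c r v : Plane → ℝ, (ContDiff ℝ ∞ c ∧ (∀ x, 0 < c x) ∧ ∀ᶠ x in 𝓝 x₀, ContDiffAt ℝ ∞ r x) ∧
      (ContDiff ℝ ∞ v ∧ v x₀ = 0 ∧ fderiv ℝ v x₀ = 0 ∧
        ∀ u, u ≠ 0 → 0 < fderiv ℝ (fderiv ℝ v) x₀ u u) ∧
      ∀ᶠ x in 𝓝 x₀,
        kineticRate A (fun y => shearedCometric (c y) (r y)) x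
          (EuclideanSpace.single 0 1 + r x • EuclideanSpace.single 1 1)
          (EuclideanSpace.single 0 1 + r x • EuclideanSpace.single 1 1)
          (EuclideanSpace.single 0 1 + r x • EuclideanSpace.single 1 1) = 0 ∧
        potentialRate A h (fun y => shearedCometric (c y) (r y)) v x
          (EuclideanSpace.single 0 1 + r x • EuclideanSpace.single 1 1) = 0 := by
  have hx₀ := mem_of_mem_nhds hS
  set ν := A x₀ w with hν_def
  let m : Plane → ℝ := fun x => (A x).inverse ν 0
  have hm₀ : m x₀ = w 0 := by
    simp [m, hν_def, (hA.isInvertible x₀ hx₀).inverse_apply_self]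
  have hν : ν ≠ 0 := by
    intro hν
    simp only [m, hν, map_zero, PiLp.zero_apply] at hm₀
    exact hw.ne hm₀
  have hM : ∀ᶠ x in 𝓝 x₀, ContDiffAt ℝ ∞ (fun y => (A y).inverse) x := by
    filter_upwards [eventually_mem_nhds_iff.2 hS] with x hx using hA.inverse.smooth.contDiffAt hx
  have hm : ∀ᶠ x in 𝓝 x₀, ContDiffAt ℝ ∞ m x := by
    filter_upwards [hM] with x hx using
      contDiffAt_euclidean.1 (hx.clm_apply contDiffAt_const) 0
  have hm_pos : ∀ᶠ x in 𝓝 x₀, 0 < m x :=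
    hm.self_of_nhds.continuousAt.eventually (lt_mem_nhds (hm₀ ▸ hw))
  obtain ⟨c, hc, hc_pos, hcν⟩ := exists_pos_fderiv_apply_eq_mul (g := fun x => -((m x)⁻¹ *
      ⟪ν, fderiv ℝ (fun y => (A y).inverse) x (EuclideanSpace.single 0 1) ν⟫_ℝ))
    (by
      filter_upwards [hM, hm, hm_pos] with x hMx hmx hmx_pos
      exact ((hmx.inv hmx_pos.ne').mul (contDiffAt_const.inner ℝ
        (((hMx.fderiv_right (m := ∞) (by simp)).clm_apply contDiffAt_const).clm_apply
          contDiffAt_const))).neg) hν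
  obtain ⟨v, hv, hvν⟩ := exists_fderiv_apply_eq_mul_fderiv_apply
    (hm.mono fun x hx => hx.mul hc.contDiffAt) (mul_pos (hm₀ ▸ hw) (hc_pos x₀)) hh hh₀ hhw
  refine ⟨c, momentumSlope A ν, v, ⟨hc, hc_pos, ?_⟩, hv, ?_⟩
  · filter_upwards [eventually_mem_nhds_iff.2 hS, hm_pos] with x hx hmx using
      contDiffAt_momentumSlope hA hx hmx.ne'
  · filter_upwards [eventually_mem_nhds_iff.2 hS, hm_pos, hcν, hvν] with x hx hmx hcx hvx
    refine ⟨?_, ?_⟩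
    · rw [kineticRate_momentumSlope hA hx hmx.ne' (hc.differentiable (by simp) x), hcx]
      simp only [m]
      ring
    · rw [potentialRate_momentumSlope (hA.isInvertible x (mem_of_mem_nhds hx)) hmx.ne', hvx]
      linear_combination c x * fderiv ℝ h x (EuclideanSpace.single 0 1) *
        inv_mul_cancel₀ hmx.ne'

theorem exists_feedback {x₀ : Plane} (hA : IsMetricOperatorOn A S) (hS : S ∈ 𝓝 x₀)
    (hh : ∀ᶠ x in 𝓝 x₀, ContDiffAt ℝ ∞ h x) (hh₀ : fderiv ℝ h x₀ = 0) {w : Plane} (hw : 0 < w 0)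
    (hhw : 0 < fderiv ℝ (fderiv ℝ h) x₀ (A x₀ w) (EuclideanSpace.single 0 1)) :
    ∃ (U : Set Plane) (F : Plane → Plane →L[ℝ] Plane) (v : Plane → ℝ) (t : Plane × Plane → ℝ),
      IsOpen U ∧ x₀ ∈ U ∧ IsMetricOperatorOn F U ∧ (ContDiff ℝ ∞ v ∧ v x₀ = 0 ∧
        fderiv ℝ v x₀ = 0 ∧ ∀ u, u ≠ 0 → 0 < fderiv ℝ (fderiv ℝ v) x₀ u u) ∧
      t (x₀, 0) = 0 ∧ ∀ x ∈ U, ∀ p, ContDiffAt ℝ ∞ t (x, p) ∧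
        fderiv ℝ (simpleEnergy F v) (x, p) (symplecticGradient (simpleEnergy A h) (x, p) +
          (0, EuclideanSpace.single 1 (t (x, p)))) = 0 := by
  obtain ⟨c, r, v, ⟨hc, hc_pos, hr⟩, hv, hmatch⟩ := exists_matching hA hS hh hh₀ hw hhw
  let F : Plane → Plane →L[ℝ] Plane := fun y => shearedCometric (c y) (r y)
  let q : Plane × Plane → Plane := fun z =>
    z.2 0 • (EuclideanSpace.single 0 1 + r z.1 • EuclideanSpace.single 1 1)
  obtain ⟨U, hU, hU_open, hxU⟩ := eventually_nhds_iff.1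
    ((eventually_mem_nhds_iff.2 hS).and (hh.and (hr.and hmatch)))
  have hF : IsMetricOperatorOn F U := isMetricOperatorOn_shearedCometric hc.contDiffOn
    (fun x _ => hc_pos x) fun x hx => (hU x hx).2.2.1.contDiffWithinAt
  refine ⟨U, F, v, fun z => matchingForce A h F v (EuclideanSpace.single 1 1) z.1 z.2 (q z),
    hU_open, hxU, hF, hv, ?_, fun x hx p => ?_⟩
  · simpa [q] using matchingForce_zero hh₀ hv.2.2.1 _
  obtain ⟨hSx, hhx, hrx, hkin, hpot⟩ := hU x hx
  have hAx := hA.smooth.contDiffAt hSx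
  have hFx := hF.smooth.contDiffAt (hU_open.mem_nhds hx)
  have hq : ContDiffAt ℝ ∞ q (x, p) :=
    ((contDiffAt_euclidean.1 contDiffAt_snd 0).smul (contDiffAt_const.add
      ((hrx.comp (x, p) contDiffAt_fst).smul contDiffAt_const)))
  refine ⟨contDiffAt_matchingForce hAx hhx hFx hv.1.contDiffAt _ p hq, ?_⟩
  have hsingle (t : ℝ) : (EuclideanSpace.single 1 t : Plane) = t • EuclideanSpace.single 1 1 := by
    ext i
    fin_cases i <;> simp
  rw [hsingle]
  exact fderiv_simpleEnergy_matchingForce (hAx.differentiableAt (by simp))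
    (hA.symm x (mem_of_mem_nhds hSx)) (hhx.differentiableAt (by simp))
    (hFx.differentiableAt (by simp)) (hF.symm x hx) (hv.1.differentiable (by simp) x)
    (slope_add_inner_shearedCometric (c x) (r x) p)
    (by rw [kineticRate_smul, hkin, mul_zero]) (by rw [potentialRate_smul, hpot, mul_zero])

end PlaneMatching

section SimpleFunction

variable {Q : Type*} [TopologicalSpace Q] [ChartedSpace Plane Q]
  {φ : OpenPartialHomeomorph Q Plane}
  {g : ∀ q : Q, TangentSpace 𝓘(ℝ, Plane) q →L[ℝ] TangentSpace 𝓘(ℝ, Plane) q →L[ℝ] ℝ}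
  {U : Set Q} {w : Q → ℝ} {x : Plane} {z : Plane × Plane}

theorem contDiffAt_comp_symm (hφ : φ ∈ IsManifold.maximalAtlas 𝓘(ℝ, Plane) ∞ Q)
    (hx : x ∈ φ.target) (hw : ContMDiffAt 𝓘(ℝ, Plane) 𝓘(ℝ, ℝ) ∞ w (φ.symm x)) :
    ContDiffAt ℝ ∞ (w ∘ φ.symm) x :=
  (hw.comp x (contMDiffAt_symm_of_mem_maximalAtlas hφ hx)).contDiffAt

theorem simpleFunction_comp_cotangentCoordSymm_eventuallyEq
    (hφ : φ ∈ IsManifold.maximalAtlas 𝓘(ℝ, Plane) ∞ Q) (hz : z.1 ∈ φ.target) :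
    simpleFunction g w ∘ cotangentCoordSymm φ =ᶠ[𝓝 z]
      simpleEnergy (localCometric φ g) (w ∘ φ.symm) := by
  filter_upwards [(φ.open_target.preimage continuous_fst).mem_nhds hz] with z' hz' using
    simpleFunction_cotangentCoordSymm hφ w hz'

variable [IsManifold 𝓘(ℝ, Plane) ∞ Q]

theorem IsRiemannianMetricOn.isMetricOperatorOn_localCometric
    (hg : IsRiemannianMetricOn g U) (hφ : φ ∈ IsManifold.maximalAtlas 𝓘(ℝ, Plane) ∞ Q)
    (hU : IsOpen U) : IsMetricOperatorOn (localCometric φ g) (φ.target ∩ φ.symm ⁻¹' U) :=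
  (hg.isMetricOperatorOn_localMetric hφ hU).inverse

theorem hamiltonianField_simpleFunction (hφ : φ ∈ IsManifold.maximalAtlas 𝓘(ℝ, Plane) ∞ Q)
    (hz : z.1 ∈ φ.target) :
    hamiltonianField φ (simpleFunction g w) (cotangentCoordSymm φ z) =
      cotangentDeriv φ z (symplecticGradient
        (simpleEnergy (localCometric φ g) (w ∘ φ.symm)) z) := by
  rw [hamiltonianField_cotangentCoordSymm hφ _ hz, symplecticGradient, symplecticGradient,
    (simpleFunction_comp_cotangentCoordSymm_eventuallyEq hφ hz).fderiv_eq]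

theorem contMDiffAt_simpleFunction (hφ : φ ∈ IsManifold.maximalAtlas 𝓘(ℝ, Plane) ∞ Q)
    (hg : IsRiemannianMetricOn g U) (hU : IsOpen U) (hw : ContMDiffOn 𝓘(ℝ, Plane) 𝓘(ℝ, ℝ) ∞ w U)
    (hz : z.1 ∈ φ.target) (hzU : φ.symm z.1 ∈ U) :
    ContMDiffAt cotangentModel 𝓘(ℝ, ℝ) ∞ (simpleFunction g w) (cotangentCoordSymm φ z) := by
  have hS : φ.target ∩ φ.symm ⁻¹' U ∈ 𝓝 z.1 :=
    (φ.symm.isOpen_inter_preimage hU).mem_nhds ⟨hz, hzU⟩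
  exact contMDiffAt_of_contDiffAt_comp_cotangentCoordSymm hφ hz ((contDiffAt_simpleEnergy
    ((hg.isMetricOperatorOn_localCometric hφ hU).smooth.contDiffAt hS)
    (contDiffAt_comp_symm hφ hz (hw.contMDiffAt (hU.mem_nhds hzU))) z.2).congr_of_eventuallyEq
      (simpleFunction_comp_cotangentCoordSymm_eventuallyEq hφ hz))

theorem differential_simpleFunction (hφ : φ ∈ IsManifold.maximalAtlas 𝓘(ℝ, Plane) ∞ Q)
    (hg : IsRiemannianMetricOn g U) (hU : IsOpen U) (hw : ContMDiffOn 𝓘(ℝ, Plane) 𝓘(ℝ, ℝ) ∞ w U)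
    (hz : z.1 ∈ φ.target) (hzU : φ.symm z.1 ∈ U) (X : Plane × Plane) :
    differential cotangentModel (simpleFunction g w) (cotangentCoordSymm φ z)
        (cotangentDeriv φ z X) =
      fderiv ℝ (simpleEnergy (localCometric φ g) (w ∘ φ.symm)) z X := by
  rw [differential_cotangentDeriv hφ hz
    ((contMDiffAt_simpleFunction hφ hg hU hw hz hzU).mdifferentiableAt (by simp)),
    (simpleFunction_comp_cotangentCoordSymm_eventuallyEq hφ hz).fderiv_eq]

theorem eventually_cotangentCoordSymm (hφ : φ ∈ IsManifold.maximalAtlas 𝓘(ℝ, Plane) ∞ Q) {q : Q}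
    (hq : q ∈ φ.source) {s : CotangentBundle Q → Prop} (hs : ∀ᶠ α in 𝓝 (covector q 0), s α) :
    ∀ᶠ z in 𝓝 (φ q, (0 : Plane)), z.1 ∈ φ.target ∧ s (cotangentCoordSymm φ z) := by
  have hx := φ.map_source hq
  have htarget : ∀ᶠ z in 𝓝 (φ q, (0 : Plane)), z.1 ∈ φ.target :=
    (φ.open_target.preimage continuous_fst).mem_nhds hx
  exact htarget.and
    ((contMDiffAt_cotangentCoordSymm hφ hx).continuousAt.eventually 
      ((cotangentCoordSymm_map_zero hq).symm ▸ hs))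

theorem hamiltonianField_simpleFunction_eq_zero_iff
    (hφ : φ ∈ IsManifold.maximalAtlas 𝓘(ℝ, Plane) ∞ Q) (hg : IsRiemannianMetricOn g U)
    (hU : IsOpen U) (hw : ContMDiffOn 𝓘(ℝ, Plane) 𝓘(ℝ, ℝ) ∞ w U) {q : Q} (hq : q ∈ φ.source)
    (hqU : q ∈ U) :
    hamiltonianField φ (simpleFunction g w) (covector q 0) = 0 ↔
      fderiv ℝ (w ∘ φ.symm) (φ q) = 0 := by
  have hx := φ.map_source hq
  have hS : φ.target ∩ φ.symm ⁻¹' U ∈ 𝓝 (φ q) :=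
    (φ.symm.isOpen_inter_preimage hU).mem_nhds ⟨hx, by simpa [φ.left_inv hq]⟩
  have hA := hg.isMetricOperatorOn_localCometric hφ hU
  have hw_comp := contDiffAt_comp_symm hφ hx
    (hw.contMDiffAt (hU.mem_nhds (by simpa [φ.left_inv hq])))
  rw [← symplecticGradient_simpleEnergy_eq_zero_iff
    ((hA.smooth.contDiffAt hS).differentiableAt (by simp)) (hA.symm _ (mem_of_mem_nhds hS))
    (hw_comp.differentiableAt (by simp)), ← cotangentCoordSymm_map_zero hq,
    hamiltonianField_simpleFunction hφ hx]
  exact map_eq_zero_iff _ (cotangentDeriv_injective hφ hx)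

end SimpleFunction

section Direction

theorem eq_smul_single_add_smul_single (p : Plane) :
    p = p 0 • EuclideanSpace.single 0 1 + p 1 • EuclideanSpace.single 1 1 := by
  ext i
  fin_cases i <;> simp

theorem exists_direction_iff {A : Plane →L[ℝ] Plane} (hA : ∀ p, p ≠ 0 → 0 < ⟪A p, p⟫_ℝ)
    (β : Plane →L[ℝ] ℝ) :
    (∃ w : Plane, 0 < w 0 ∧ 0 < β (A w)) ↔
      β (A (EuclideanSpace.single 1 1)) ≠ 0 ∨ 0 < β (EuclideanSpace.single 0 1) := by
  have hβA (w : Plane) : β (A w) =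
      w 0 * β (A (EuclideanSpace.single 0 1)) + w 1 * β (A (EuclideanSpace.single 1 1)) := by
    conv_lhs => rw [eq_smul_single_add_smul_single w]
    simp only [map_add, map_smul, smul_eq_mul]
  obtain ⟨w₀, hAw₀⟩ : ∃ w₀, A w₀ = EuclideanSpace.single 0 1 :=
    ⟨_, (isInvertible_of_inner_pos hA).self_apply_inverse _⟩
  have hw₀ : 0 < w₀ 0 := by
    have hne : w₀ ≠ 0 := by
      rintro rfl
      simpa using congrArg (fun p : Plane => p 0) hAw₀
    simpa [hAw₀, EuclideanSpace.inner_single_left] using hA w₀ hne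
  constructor
  · rintro ⟨w, hw, hβw⟩
    refine or_iff_not_imp_left.2 fun hzero => ?_
    rw [hβA, not_not.1 hzero, mul_zero, add_zero] at hβw
    rw [← hAw₀, hβA, not_not.1 hzero, mul_zero, add_zero]
    exact mul_pos hw₀ (pos_of_mul_pos_right hβw hw.le)
  · rintro (hne | hpos)
    · refine ⟨EuclideanSpace.single 0 1 +
        ((1 - β (A (EuclideanSpace.single 0 1))) / β (A (EuclideanSpace.single 1 1))) •
          EuclideanSpace.single 1 1, by simp, ?_⟩
      simp only [map_add, map_smul, smul_eq_mul, div_mul_cancel₀ _ hne, add_sub_cancel,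
        zero_lt_one]
    · exact ⟨w₀, hw₀, by rwa [hAw₀]⟩

end Direction

section Stabilizable

variable {Q : Type*} [TopologicalSpace Q] [ChartedSpace Plane Q] [IsManifold 𝓘(ℝ, Plane) ∞ Q]
  {φ : OpenPartialHomeomorph Q Plane}
  {g : ∀ q : Q, TangentSpace 𝓘(ℝ, Plane) q →L[ℝ] TangentSpace 𝓘(ℝ, Plane) q →L[ℝ] ℝ}
  {v : Q → ℝ} {q₀ : Q} {O : Set (CotangentBundle Q)}
  {X : ∀ α : CotangentBundle Q, TangentSpace cotangentModel α}

theorem IsLyapunovFunction.fderiv_potential_eq_zero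
    (hV : IsLyapunovFunction cotangentModel X O (covector q₀ 0) (simpleFunction g v))
    (hφ : φ ∈ IsManifold.maximalAtlas 𝓘(ℝ, Plane) ∞ Q) (hq₀ : q₀ ∈ φ.source)
    (hO : O ∈ 𝓝 (covector q₀ 0)) : fderiv ℝ (v ∘ φ.symm) (φ q₀) = 0 := by
  have hV_zero (q : Q) : simpleFunction g v (covector q 0) = v q := by simp [simpleFunction]
  refine IsLocalMin.fderiv_eq_zero ?_
  have hline : Tendsto (fun x : Plane => (x, (0 : Plane))) (𝓝 (φ q₀)) (𝓝 (φ q₀, 0)) :=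
    (by fun_prop : Continuous fun x : Plane => (x, (0 : Plane))).tendsto _
  filter_upwards [hline.eventually (eventually_cotangentCoordSymm hφ hq₀ hO)] with x hx
  rw [cotangentCoordSymm_zero] at hx
  rw [Function.comp_apply, Function.comp_apply, φ.left_inv hq₀, ← hV_zero, ← hV_zero, hV.zero]
  by_cases hne : covector (φ.symm x) 0 = covector q₀ 0
  · rw [hne, hV.zero]
  · exact (hV.pos _ hx.2 hne).le

theorem StabilizableBySimpleLyapunov.exists_direction {h : Q → ℝ}
    {ξ : ∀ q : Q, TangentSpace 𝓘(ℝ, Plane) q →L[ℝ] ℝ}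
    (hstab : StabilizableBySimpleLyapunov φ (simpleFunction g h) ξ q₀)
    (hφ : φ ∈ IsManifold.maximalAtlas 𝓘(ℝ, Plane) ∞ Q) (hq₀ : q₀ ∈ φ.source)
    (hg : IsRiemannianMetricOn g univ) (hh : ContMDiff 𝓘(ℝ, Plane) 𝓘(ℝ, ℝ) ∞ h)
    (hξ : IsAdapted φ ξ) :
    ∃ w : Plane, 0 < w 0 ∧
      0 < hessian φ h q₀ (localCometric φ g (φ q₀) w) (EuclideanSpace.single 0 1) := by
  obtain ⟨U, O, Y, g', v, hU, hqU, -, hO, hqO, hOU, -, hY, -, hg', hv, hV, hv_pos⟩ := hstab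
  have hx := φ.map_source hq₀
  have hqU' : φ.symm (φ q₀) ∈ U := by rwa [φ.left_inv hq₀]
  have hO_nhds := hO.mem_nhds hqO
  have hA := (hg.isMetricOperatorOn_localCometric hφ isOpen_univ).mono
    (inter_subset_inter_right φ.target (preimage_mono (subset_univ U)))
  have hF := hg'.isMetricOperatorOn_localCometric hφ hU
  obtain ⟨w, hw, hhw⟩ := exists_fderiv_fderiv_pos_of_nonpos
    (e := (EuclideanSpace.single 0 1 : Plane))
    ((φ.symm.isOpen_inter_preimage hU).mem_nhds ⟨hx, hqU'⟩) hA
    (contDiffAt_comp_symm hφ hx (hh _)) hF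
    (contDiffAt_comp_symm hφ hx (hv.contMDiffAt (hU.mem_nhds hqU')))
    (hV.fderiv_potential_eq_zero hφ hq₀ hO_nhds) hv_pos (by simp) (by
      filter_upwards [eventually_cotangentCoordSymm hφ hq₀ hO_nhds] with z ⟨hz, hzO⟩
      obtain ⟨t, ht⟩ := (mem_actuation_cotangentCoordSymm_iff hφ hξ hz _).1 (hY _ hzO)
      refine ⟨EuclideanSpace.single 1 t, by simp [EuclideanSpace.inner_single_left], ?_⟩
      have hle := hV.deriv_nonpos _ hzO
      rw [hamiltonianField_simpleFunction hφ hz, ht] at hle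
      rw [← differential_simpleFunction hφ hg' hU hv hz (hOU _ hzO), map_add]
      exact hle)
  exact ⟨w, by simpa [EuclideanSpace.inner_single_left] using hw, hhw⟩

end Stabilizable

section Stability

variable {E H P : Type*} [NormedAddCommGroup E] [NormedSpace ℝ E] [TopologicalSpace H]
  {I : ModelWithCorners ℝ E H} [TopologicalSpace P] [ChartedSpace H P]
  {X : ∀ α : P, TangentSpace I α} {O : Set P} {α₀ : P} {V : P → ℝ}

theorem IsLyapunovFunction.exists_hasDerivWithinAt (hV : IsLyapunovFunction I X O α₀ V)
    (hO : IsOpen O) {s : Set ℝ} {Γ : ℝ → P} (hΓ : IsMIntegralCurveOn (I := I) Γ X s) {t : ℝ}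
    (ht : t ∈ s) (htO : Γ t ∈ O) : ∃ d ≤ 0, HasDerivWithinAt (fun t => V (Γ t)) d s t := by
  have hVΓ := (((hV.smooth _ htO).contMDiffAt (hO.mem_nhds htO)).mdifferentiableAt
    (by simp)).hasMFDerivAt.comp_hasMFDerivWithinAt t (hΓ t ht)
  have hderiv : HasFDerivWithinAt (𝕜 := ℝ) (E := ℝ) (F := ℝ) (fun t => V (Γ t)) _ s t :=
    hVΓ.hasFDerivWithinAt
  refine ⟨_, ?_, hderiv.hasDerivWithinAt⟩
  change differential I V (Γ t) ((1 : ℝ) • X (Γ t)) ≤ 0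
  rw [one_smul]
  exact hV.deriv_nonpos _ htO

theorem IsLyapunovFunction.antitoneOn (hV : IsLyapunovFunction I X O α₀ V)
    (hO : IsOpen O) {T : ℝ} {Γ : ℝ → P} (hΓ : IsMIntegralCurveOn (I := I) Γ X (Ico 0 T))
    (hΓO : ∀ t ∈ Ico 0 T, Γ t ∈ O) : AntitoneOn (fun t => V (Γ t)) (Ico 0 T) := by
  choose! d hd hderiv using fun t (ht : t ∈ Ico 0 T) =>
    hV.exists_hasDerivWithinAt hO hΓ ht (hΓO t ht)
  exact antitoneOn_of_hasDerivWithinAt_nonpos (convex_Ico 0 T)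
    (fun t ht => (hderiv t ht).continuousWithinAt)
    (fun t ht => (hderiv t (interior_subset ht)).mono interior_subset)
    fun t ht => hd t (interior_subset ht)

theorem IsLyapunovFunction.exists_pos_le_on_sphere {F : Type*} [PseudoMetricSpace F]
    [ProperSpace F] (hV : IsLyapunovFunction I X O α₀ V) (e : OpenPartialHomeomorph P F) {ε : ℝ}
    (hε : 0 < ε) (hball : Metric.closedBall (e α₀) ε ⊆ e.target ∩ e.symm ⁻¹' O) :
    ∃ m > 0, ∀ y ∈ Metric.sphere (e α₀) ε, m ≤ V (e.symm y) := by
  have hsphere := Metric.sphere_subset_closedBall.trans hball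
  refine (isCompact_sphere (e α₀) ε).exists_forall_le' (hV.smooth.continuousOn.comp
    (e.continuousOn_symm.mono fun y hy => (hsphere hy).1) fun y hy => (hsphere hy).2)
    fun y hy => hV.pos _ (hsphere hy).2 fun h => hε.ne ?_
  rwa [Metric.mem_sphere, ← e.right_inv (hsphere hy).1, h, dist_self] at hy

theorem IsLyapunovFunction.isStableAt {F : Type*} [PseudoMetricSpace F] [ProperSpace F]
    (hV : IsLyapunovFunction I X O α₀ V) (hO : IsOpen O) (hα₀ : α₀ ∈ O)
    (e : OpenPartialHomeomorph P F) (he : O ⊆ e.source) : IsStableAt I X O α₀ := by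
  intro N hN
  have hNO : e.target ∩ e.symm ⁻¹' (N ∩ O) ∈ 𝓝 (e α₀) :=
    inter_mem (e.open_target.mem_nhds (e.map_source (he hα₀)))
      (e.continuousAt_symm (e.map_source (he hα₀))
        ((e.left_inv (he hα₀)).symm ▸ inter_mem hN (hO.mem_nhds hα₀)))
  obtain ⟨ε, hε, hball⟩ := Metric.nhds_basis_closedBall.mem_iff.1 hNO
  obtain ⟨m, hm, hmin⟩ := hV.exists_pos_le_on_sphere e hε
    fun y hy => ⟨(hball hy).1, (hball hy).2.2⟩
  refine ⟨e ⁻¹' Metric.ball (e α₀) ε ∩ V ⁻¹' Iio m, inter_mem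
    ((e.continuousAt (he hα₀)) (Metric.ball_mem_nhds _ hε))
    (hV.smooth.continuousOn.continuousAt (hO.mem_nhds hα₀) (Iio_mem_nhds (hV.zero.trans_lt hm))),
    ?_⟩
  rintro T Γ hΓ hΓO ⟨hdist₀, hVΓ₀⟩ t ht
  have hIcc : Icc 0 t ⊆ Ico 0 T := Icc_subset_Ico_right ht.2
  have hdist : dist (e (Γ t)) (e α₀) < ε := by
    by_contra! hge
    have hcont : ContinuousOn (fun s => dist (e (Γ s)) (e α₀)) (Icc 0 t) :=
      (continuous_id.dist continuous_const).comp_continuousOn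
        ((e.continuousOn.comp (fun s hs => (hΓ s hs).continuousWithinAt)
          fun s hs => he (hΓO s hs)).mono hIcc)
    obtain ⟨s, hs, hdist_s⟩ := intermediate_value_Icc ht.1 hcont ⟨le_of_lt hdist₀, hge⟩
    have hm_le := hmin _ (Metric.mem_sphere.2 hdist_s)
    rw [e.left_inv (he (hΓO s (hIcc hs)))] at hm_le
    exact (hm_le.trans
      (hV.antitoneOn hO hΓ hΓO (hIcc ⟨le_rfl, ht.1⟩) (hIcc hs) hs.1)).not_gt hVΓ₀
  have hmem := (hball (Metric.ball_subset_closedBall (Metric.mem_ball.2 hdist))).2.1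
  rwa [e.left_inv (he (hΓO t ht))] at hmem

end Stability

section Sufficiency

theorem hessian_comp_eq_fderiv_fderiv {Q : Type*} [TopologicalSpace Q]
    {φ : OpenPartialHomeomorph Q Plane} {q₀ : Q} (hq₀ : q₀ ∈ φ.source) (v : Plane → ℝ) :
    hessian φ (v ∘ φ) q₀ = fderiv ℝ (fderiv ℝ v) (φ q₀) := by
  have heq : (fun x => (v ∘ φ) (φ.symm x)) =ᶠ[𝓝 (φ q₀)] v := by
    filter_upwards [φ.open_target.mem_nhds (φ.map_source hq₀)] with x hx
    rw [Function.comp_apply, φ.right_inv hx]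
  rw [hessian, heq.fderiv.fderiv_eq]

variable {Q : Type*} [TopologicalSpace Q] [ChartedSpace Plane Q] [IsManifold 𝓘(ℝ, Plane) ∞ Q]
  {φ : OpenPartialHomeomorph Q Plane}
  {ξ : ∀ q : Q, TangentSpace 𝓘(ℝ, Plane) q →L[ℝ] ℝ}
  {K : CotangentBundle Q → ℝ} {X : ∀ α : CotangentBundle Q, TangentSpace cotangentModel α}
  {F : Plane → Plane →L[ℝ] Plane} {v : Plane → ℝ} {t : Plane × Plane → ℝ} {S : Set Plane}
  {q₀ : Q} {x₀ : Plane} {z : Plane × Plane} {α : CotangentBundle Q}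

theorem isOpen_proj_preimage {U : Set Q} (hU : IsOpen U) :
    IsOpen {α : CotangentBundle Q | α.proj ∈ U} :=
  hU.preimage (FiberBundle.continuous_proj (Plane →L[ℝ] ℝ)
    (fun q : Q => TangentSpace 𝓘(ℝ, Plane) q →L[ℝ] ℝ))

/-- The chart of the cotangent bundle induced by a chart of the base. -/
def cotangentChart (hφ : φ ∈ IsManifold.maximalAtlas 𝓘(ℝ, Plane) ∞ Q) :
    OpenPartialHomeomorph (CotangentBundle Q) (Plane × Plane) where
  toFun := cotangentCoord φ
  invFun := cotangentCoordSymm φ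
  source := {α | α.proj ∈ φ.source}
  target := φ.target ×ˢ univ
  map_source' _ hα := ⟨φ.map_source hα, mem_univ _⟩
  map_target' _ hz := φ.map_target hz.1
  left_inv' _ hα := cotangentCoordSymm_cotangentCoord hφ hα
  right_inv' _ hz := cotangentCoord_cotangentCoordSymm hφ hz.1
  open_source := isOpen_proj_preimage φ.open_source
  open_target := φ.open_target.prod isOpen_univ
  continuousOn_toFun _ hα := (contMDiffAt_cotangentCoord hφ hα).continuousAt.continuousWithinAt
  continuousOn_invFun _ hz :=
    (contMDiffAt_cotangentCoordSymm hφ hz.1).continuousAt.continuousWithinAt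

/-- The control law on the cotangent bundle which, in the coordinates of the chart `φ`, is the
force of strength `t` in the direction `dy`. -/
def controlLaw (φ : OpenPartialHomeomorph Q Plane) (t : Plane × Plane → ℝ)
    (α : CotangentBundle Q) : TangentSpace cotangentModel α :=
  cotangentDeriv φ (cotangentCoord φ α) (0, EuclideanSpace.single 1 (t (cotangentCoord φ α)))

theorem contMDiffAt_controlLaw (hφ : φ ∈ IsManifold.maximalAtlas 𝓘(ℝ, Plane) ∞ Q)
    (hα : α.proj ∈ φ.source) (ht : ContDiffAt ℝ ∞ t (cotangentCoord φ α)) :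
    ContMDiffAt cotangentModel cotangentModel.tangent ∞
      (fun α => (⟨α, controlLaw φ t α⟩ : TangentBundle cotangentModel (CotangentBundle Q))) α := by
  refine contMDiffAt_pushforward (S := φ.target ×ˢ univ) (φ.open_target.prod isOpen_univ)
    (fun z hz => (contMDiffAt_cotangentCoordSymm hφ hz.1).contMDiffWithinAt)
    (contMDiffAt_cotangentCoord hφ hα) ⟨φ.map_source hα, mem_univ _⟩ ?_
    (X := fun z => (0, EuclideanSpace.single 1 (t z)))
    (contDiffAt_const.prodMk (contDiffAt_euclidean.2 fun i => ?_))
  · filter_upwards [(isOpen_proj_preimage φ.open_source).mem_nhds hα] with β hβ using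
      cotangentCoordSymm_cotangentCoord hφ hβ
  · fin_cases i
    · simpa using contDiffAt_const
    · simpa using ht

theorem controlLaw_cotangentCoordSymm (hφ : φ ∈ IsManifold.maximalAtlas 𝓘(ℝ, Plane) ∞ Q)
    (t : Plane × Plane → ℝ) (hz : z.1 ∈ φ.target) :
    controlLaw φ t (cotangentCoordSymm φ z) =
      cotangentDeriv φ z (0, EuclideanSpace.single 1 (t z)) := by
  change cotangentDeriv φ (cotangentCoord φ (cotangentCoordSymm φ z))
    (0, EuclideanSpace.single 1 (t (cotangentCoord φ (cotangentCoordSymm φ z)))) = _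
  rw [cotangentCoord_cotangentCoordSymm hφ hz]

theorem controlLaw_mem_actuation (hφ : φ ∈ IsManifold.maximalAtlas 𝓘(ℝ, Plane) ∞ Q)
    (hξ : IsAdapted φ ξ) (t : Plane × Plane → ℝ) (hα : α.proj ∈ φ.source) :
    controlLaw φ t α ∈ actuation ξ α := by
  obtain ⟨z, hz, rfl⟩ : ∃ z : Plane × Plane, z.1 ∈ φ.target ∧ cotangentCoordSymm φ z = α :=
    ⟨_, φ.map_source hα, cotangentCoordSymm_cotangentCoord hφ hα⟩
  exact (mem_actuation_cotangentCoordSymm_iff hφ hξ hz _).2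
    ⟨_, controlLaw_cotangentCoordSymm hφ t hz⟩

theorem simpleEnergy_pos (hF : ∀ p, p ≠ 0 → 0 < ⟪F z.1 p, p⟫_ℝ) (hv₀ : v x₀ = 0)
    (hv : z.1 ≠ x₀ → 0 < v z.1) (hz : z ≠ (x₀, 0)) : 0 < simpleEnergy F v z := by
  have hv_nonneg : 0 ≤ v z.1 := by
    obtain heq | hne := eq_or_ne z.1 x₀
    · rw [heq, hv₀]
    · exact (hv hne).le
  rw [simpleEnergy, real_inner_comm]
  obtain hp | hp := eq_or_ne z.2 0
  · simpa [hp] using hv fun hx => hz (Prod.ext hx hp)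
  · linarith [hF z.2 hp]

theorem isLyapunovFunction_coordMetric (hφ : φ ∈ IsManifold.maximalAtlas 𝓘(ℝ, Plane) ∞ Q)
    (hq₀ : q₀ ∈ φ.source) (hS : IsOpen S) (hF : IsMetricOperatorOn F S) (hv : ContDiffOn ℝ ∞ v S)
    (hv₀ : v (φ q₀) = 0) (hv_pos : ∀ x ∈ S, x ≠ φ q₀ → 0 < v x) (hX₀ : X (covector q₀ 0) = 0)
    (hX : ∀ z : Plane × Plane, z.1 ∈ φ.target → z.1 ∈ S → ∃ Z, fderiv ℝ (simpleEnergy F v) z Z ≤ 0 ∧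
      X (cotangentCoordSymm φ z) = cotangentDeriv φ z Z) :
    IsLyapunovFunction cotangentModel X {α | α.proj ∈ φ.source ∩ φ ⁻¹' S} (covector q₀ 0)
      (simpleFunction (coordMetric φ fun x => (F x).inverse) (v ∘ φ)) := by
  have hV (z : Plane × Plane) (hz : z.1 ∈ φ.target) (hzS : z.1 ∈ S) :=
    simpleFunction_coordMetric_inverse hφ v hz (hF.isInvertible _ hzS)
  have hV_eventually (z : Plane × Plane) (hz : z.1 ∈ φ.target) (hzS : z.1 ∈ S) :
      simpleFunction (coordMetric φ fun x => (F x).inverse) (v ∘ φ) ∘ cotangentCoordSymm φ =ᶠ[𝓝 z]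
        simpleEnergy F v := by
    filter_upwards [((φ.open_target.inter hS).preimage continuous_fst).mem_nhds ⟨hz, hzS⟩]
      with z' hz' using hV z' hz'.1 hz'.2
  have hV_smooth (z : Plane × Plane) (hz : z.1 ∈ φ.target) (hzS : z.1 ∈ S) :=
    contMDiffAt_of_contDiffAt_comp_cotangentCoordSymm hφ hz ((contDiffAt_simpleEnergy
      (hF.smooth.contDiffAt (hS.mem_nhds hzS)) (hv.contDiffAt (hS.mem_nhds hzS))
      z.2).congr_of_eventuallyEq (hV_eventually z hz hzS))
  have hcoord {α : CotangentBundle Q} (hα : α.proj ∈ φ.source ∩ φ ⁻¹' S) :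
      ∃ z : Plane × Plane, z.1 ∈ φ.target ∧ z.1 ∈ S ∧ cotangentCoordSymm φ z = α :=
    ⟨cotangentCoord φ α, φ.map_source hα.1, hα.2, cotangentCoordSymm_cotangentCoord hφ hα.1⟩
  refine ⟨hX₀, fun α hα => ?_, by simp [simpleFunction, hv₀], fun α hα hne => ?_,
    fun α hα => ?_⟩ <;>
    obtain ⟨z, hz, hzS, rfl⟩ := hcoord hα
  · exact (hV_smooth z hz hzS).contMDiffWithinAt
  · rw [hV z hz hzS]
    refine simpleEnergy_pos (hF.pos _ hzS) hv₀ (hv_pos _ hzS) ?_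
    rintro rfl
    exact hne (cotangentCoordSymm_map_zero hq₀)
  · obtain ⟨Z, hZ, hXZ⟩ := hX z hz hzS
    rw [hXZ, differential_cotangentDeriv hφ hz ((hV_smooth z hz hzS).mdifferentiableAt (by simp)),
      (hV_eventually z hz hzS).fderiv_eq]
    exact hZ

theorem stabilizable_of_feedback (hφ : φ ∈ IsManifold.maximalAtlas 𝓘(ℝ, Plane) ∞ Q)
    (hξ : IsAdapted φ ξ) (hq₀ : q₀ ∈ φ.source)
    (hcrit : hamiltonianField φ K (covector q₀ 0) = 0) (hS : IsOpen S) (hxS : φ q₀ ∈ S)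
    (hF : IsMetricOperatorOn F S) (hv : ContDiffOn ℝ ∞ v S) (hv₀ : v (φ q₀) = 0)
    (hv_pos : ∀ x ∈ S, x ≠ φ q₀ → 0 < v x)
    (hv_hess : ∀ u, u ≠ 0 → 0 < fderiv ℝ (fderiv ℝ v) (φ q₀) u u) (ht₀ : t (φ q₀, 0) = 0)
    (ht : ∀ z : Plane × Plane, z.1 ∈ S → ContDiffAt ℝ ∞ t z)
    (hdecay : ∀ z : Plane × Plane, z.1 ∈ φ.target → z.1 ∈ S → fderiv ℝ (simpleEnergy F v) z
      (symplecticGradient (K ∘ cotangentCoordSymm φ) z + (0, EuclideanSpace.single 1 (t z))) ≤ 0) :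
    StabilizableBySimpleLyapunov φ K ξ q₀ := by
  have hcontrol₀ : controlLaw φ t (covector q₀ 0) = 0 := by
    have hlaw := controlLaw_cotangentCoordSymm hφ t (z := (φ q₀, 0)) (φ.map_source hq₀)
    rw [cotangentCoordSymm_map_zero hq₀] at hlaw
    have hzero : ((0, EuclideanSpace.single 1 (t (φ q₀, 0))) : Plane × Plane) = 0 := by simp [ht₀]
    exact hlaw.trans (hzero ▸ map_zero (cotangentDeriv φ (φ q₀, 0)))
  have hV := isLyapunovFunction_coordMetric
    (X := fun α => hamiltonianField φ K α + controlLaw φ t α) hφ hq₀ hS hF hv hv₀ hv_pos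
    (by rw [hcrit, hcontrol₀, add_zero]) fun z hz hzS => ⟨_, hdecay z hz hzS, by
      rw [hamiltonianField_cotangentCoordSymm hφ K hz, controlLaw_cotangentCoordSymm hφ t hz]
      exact (map_add (cotangentDeriv φ z) _ _).symm⟩
  have hU : IsOpen (φ.source ∩ φ ⁻¹' S) := φ.isOpen_inter_preimage hS
  have hO := isOpen_proj_preimage hU
  refine ⟨φ.source ∩ φ ⁻¹' S, {α | α.proj ∈ φ.source ∩ φ ⁻¹' S}, controlLaw φ t, _, _, hU,
    ⟨hq₀, hxS⟩, inter_subset_left, hO, ⟨hq₀, hxS⟩, fun α hα => hα, fun α hα => ?_,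
    fun α hα => controlLaw_mem_actuation hφ hξ t hα.1,
    hV.isStableAt hO ⟨hq₀, hxS⟩ (cotangentChart hφ) fun α hα => hα.1,
    isRiemannianMetricOn_coordMetric hφ hF.inverse hS inter_subset_left fun q hq => hq.2,
    fun q hq => ?_, hV, by rwa [hessian_comp_eq_fderiv_fderiv hq₀]⟩
  · exact (contMDiffAt_controlLaw hφ hα.1 (ht _ hα.2)).contMDiffWithinAt
  · exact ((hv.contDiffAt (hS.mem_nhds hq.2)).contMDiffAt.comp q
      (contMDiffAt_of_mem_maximalAtlas hφ hq.1)).contMDiffWithinAt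

variable {g : ∀ q : Q, TangentSpace 𝓘(ℝ, Plane) q →L[ℝ] TangentSpace 𝓘(ℝ, Plane) q →L[ℝ] ℝ}
  {h : Q → ℝ}

theorem stabilizable_of_exists_direction (hφ : φ ∈ IsManifold.maximalAtlas 𝓘(ℝ, Plane) ∞ Q)
    (hq₀ : q₀ ∈ φ.source) (hg : IsRiemannianMetricOn g univ)
    (hh : ContMDiff 𝓘(ℝ, Plane) 𝓘(ℝ, ℝ) ∞ h) (hξ : IsAdapted φ ξ)
    (hcrit : hamiltonianField φ (simpleFunction g h) (covector q₀ 0) = 0) {w : Plane}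
    (hw : 0 < w 0)
    (hhw : 0 < hessian φ h q₀ (localCometric φ g (φ q₀) w) (EuclideanSpace.single 0 1)) :
    StabilizableBySimpleLyapunov φ (simpleFunction g h) ξ q₀ := by
  have htarget : φ.target ∈ 𝓝 (φ q₀) := φ.open_target.mem_nhds (φ.map_source hq₀)
  have hA : IsMetricOperatorOn (localCometric φ g) φ.target :=
    (hg.isMetricOperatorOn_localCometric hφ isOpen_univ).mono fun x hx => ⟨hx, mem_univ _⟩
  obtain ⟨S, F, v, t, hS, hxS, hF, ⟨hv, hv₀, hdv, hv_hess⟩, ht₀, ht⟩ := exists_feedback hA htarget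
    (by filter_upwards [htarget] with x hx using contDiffAt_comp_symm hφ hx (hh _))
    ((hamiltonianField_simpleFunction_eq_zero_iff hφ hg isOpen_univ hh.contMDiffOn hq₀
      (mem_univ _)).1 hcrit) hw hhw
  obtain ⟨W, hW, hW_open, hxW⟩ := eventually_nhds_iff.1
    (eventually_pos_of_isCoercive_fderiv_fderiv hv.contDiffAt hv₀ hdv (isCoercive_of_pos hv_hess))
  refine stabilizable_of_feedback hφ hξ hq₀ hcrit (hS.inter hW_open) ⟨hxS, hxW⟩
    (hF.mono inter_subset_left) hv.contDiffOn hv₀ (fun x hx => hW x hx.2) hv_hess ht₀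
    (fun z hz => (ht z.1 hz.1 z.2).1) fun z hz hzS => ?_
  rw [symplecticGradient,
    (simpleFunction_comp_cotangentCoordSymm_eventuallyEq hφ hz).fderiv_eq]
  exact (ht z.1 hzS.1 z.2).2.le

end Sufficiency

section Condition

variable {Q : Type*} [TopologicalSpace Q] [ChartedSpace Plane Q]
  {φ : OpenPartialHomeomorph Q Plane}
  {g : ∀ q : Q, TangentSpace 𝓘(ℝ, Plane) q →L[ℝ] TangentSpace 𝓘(ℝ, Plane) q →L[ℝ] ℝ}
  {h : Q → ℝ} {q₀ : Q}

theorem hessian_localCometric_single (hφ : φ ∈ IsManifold.maximalAtlas 𝓘(ℝ, Plane) ∞ Q)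
    (hq₀ : q₀ ∈ φ.source) (hh : ContMDiff 𝓘(ℝ, Plane) 𝓘(ℝ, ℝ) ∞ h) :
    hessian φ h q₀ (localCometric φ g (φ q₀) (EuclideanSpace.single 1 1))
        (EuclideanSpace.single 0 1) =
      cometricCoeff φ g 0 1 q₀ * secondPartial φ h 0 0 q₀ +
        cometricCoeff φ g 1 1 q₀ * secondPartial φ h 0 1 q₀ := by
  have hx := φ.map_source hq₀
  have hcoeff (i : Fin 2) :
      cometricCoeff φ g i 1 q₀ = localCometric φ g (φ q₀) (EuclideanSpace.single 1 1) i := by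
    rw [← cometricCoeff_eq_localCometric hφ hx, φ.left_inv hq₀]
  have hsymm (u w : Plane) : hessian φ h q₀ u w = hessian φ h q₀ w u :=
    fderiv_fderiv_comm (contDiffAt_comp_symm hφ hx (hh _)) u w
  rw [hcoeff, hcoeff, hsymm, secondPartial, secondPartial]
  conv_lhs => rw [eq_smul_single_add_smul_single (localCometric φ g (φ q₀) _)]
  simp only [map_add, map_smul, smul_eq_mul]

variable [IsManifold 𝓘(ℝ, Plane) ∞ Q]

theorem isRiemannianMetricOn_inner
    (ρ : ContMDiffRiemannianMetric 𝓘(ℝ, Plane) ∞ Plane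
      (fun q : Q => TangentSpace 𝓘(ℝ, Plane) q)) : IsRiemannianMetricOn ρ.inner univ where
  symm q _ := ρ.symm q
  pos q _ := ρ.pos q
  smooth := ρ.contMDiff.contMDiffOn

theorem exists_direction_hessian_iff (hφ : φ ∈ IsManifold.maximalAtlas 𝓘(ℝ, Plane) ∞ Q)
    (hq₀ : q₀ ∈ φ.source) (hg : IsRiemannianMetricOn g univ)
    (hh : ContMDiff 𝓘(ℝ, Plane) 𝓘(ℝ, ℝ) ∞ h) :
    (∃ w : Plane, 0 < w 0 ∧
      0 < hessian φ h q₀ (localCometric φ g (φ q₀) w) (EuclideanSpace.single 0 1)) ↔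
      cometricCoeff φ g 0 1 q₀ * secondPartial φ h 0 0 q₀ +
          cometricCoeff φ g 1 1 q₀ * secondPartial φ h 0 1 q₀ ≠ 0 ∨
        0 < secondPartial φ h 0 0 q₀ := by
  rw [← hessian_localCometric_single hφ hq₀ hh]
  exact exists_direction_iff ((hg.isMetricOperatorOn_localCometric hφ isOpen_univ).pos _
    ⟨φ.map_source hq₀, mem_univ _⟩) ((hessian φ h q₀).flip (EuclideanSpace.single 0 1))

end Condition

end Underactuated

end

theorem mainTheorem2 {Q : Type*} [TopologicalSpace Q] [T2Space Q]
    [ChartedSpace Underactuated.Plane Q] [IsManifold 𝓘(ℝ, Underactuated.Plane) ∞ Q]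
    (ρ : ContMDiffRiemannianMetric 𝓘(ℝ, Underactuated.Plane) ∞ Underactuated.Plane
      (fun q : Q => TangentSpace 𝓘(ℝ, Underactuated.Plane) q))
    (h : Q → ℝ) (hh : ContMDiff 𝓘(ℝ, Underactuated.Plane) 𝓘(ℝ, ℝ) ∞ h)
    (ξ : ∀ q : Q, TangentSpace 𝓘(ℝ, Underactuated.Plane) q →L[ℝ] ℝ)
    (hξ : ContMDiff 𝓘(ℝ, Underactuated.Plane) Underactuated.cotangentModel ∞
      (fun q => Underactuated.covector q (ξ q)))
    (hξ_ne : ∀ q, ξ q ≠ 0)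
    (q₀ : Q) (φ : OpenPartialHomeomorph Q Underactuated.Plane)
    (hφ : φ ∈ IsManifold.maximalAtlas 𝓘(ℝ, Underactuated.Plane) ∞ Q)
    (hq₀ : q₀ ∈ φ.source) (hφ₀ : φ q₀ = 0)
    (hadapted : Underactuated.IsAdapted φ ξ)
    (hcrit : Underactuated.hamiltonianField φ (Underactuated.simpleFunction ρ.inner h)
      (Underactuated.covector q₀ 0) = 0) :
    Underactuated.StabilizableBySimpleLyapunov φ
        (Underactuated.simpleFunction ρ.inner h) ξ q₀ ↔
      (Underactuated.cometricCoeff φ ρ.inner 0 1 q₀ * Underactuated.secondPartial φ h 0 0 q₀ +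
          Underactuated.cometricCoeff φ ρ.inner 1 1 q₀ * Underactuated.secondPartial φ h 0 1 q₀
            ≠ 0 ∨
        0 < Underactuated.secondPartial φ h 0 0 q₀) := by
  have hρ := Underactuated.isRiemannianMetricOn_inner ρ
  rw [← Underactuated.exists_direction_hessian_iff hφ hq₀ hρ hh]
  exact ⟨fun hstab => hstab.exists_direction hφ hq₀ hρ hh hadapted, fun ⟨w, hw, hhw⟩ =>
    Underactuated.stabilizable_of_exists_direction hφ hq₀ hρ hh hadapted hcrit hw hhw⟩
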